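/- Let $F=M_m(\mathbb C)$, let $E=\bigoplus_{j=1}^k M_{d_j}(\mathbb C)$, and let $\alpha_0,\alpha_1\colon E\to F$ be $^*$-homomorphisms such that $\alpha_0\oplus\alpha_1\colon E\to F\oplus F$ is injective and each of $\alpha_0$, $\alpha_1$ is supported on a single component of $E$ (that is, nonzero on at most one summand). Let $B$ be a unital $C^*$-algebra that is $^*$-isomorphic to the (nice) one dimensional NCCW complex \[ \{(f,g)\in C([0,1],F)\oplus E \mid f(0)=\alpha_0(g),\ f(1)=\alpha_1(g)\}, \] and for $b\in B$ write $b(t)\in M_m(\mathbb C)$ for the value at $t\in[0,1]$ of the $C([0,1],F)$-component of $b$. Let $\varphi,\psi\colon C([0,1])\to B$ be unital $^*$-monomorphisms. Then $\varphi$ and $\psi$ are diagonal: there are continuous maps $\xi^\varphi_1\le\dots\le\xi^\varphi_m\colon[0,1]\to[0,1]$ and unitaries $u(t)\in M_m(\mathbb C)$ with \[ \varphi(f)(t)=u(t)\,\mathrm{diag}\big(f(\xi^\varphi_1(t)),\dots,f(\xi^\varphi_m(t))\big)\,u(t)^*\qquad (f\in C([0,1]),\ t\in[0,1]), \] and likewise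 for $\psi$ with maps $\xi^\psi_1\le\dots\le\xi^\psi_m$. Moreover, for any such associated maps, \[ d_{\mathcal U}(\varphi,\psi)=d_\partial(\varphi,\psi)=d_W(\varphi,\psi). \] Here, with $\mathcal L=\mathrm{Lip}([0,1])=\{f\colon[0,1]\to\mathbb R \mid |f(x)-f(y)|\le|x-y|\text{ for all }x,y\}$, \[ d_{\mathcal U}(\varphi,\psi)=\sup_{S\subseteq\mathcal L\text{ finite}}\ \inf_{u\in\mathcal U(B)}\ \sup_{f\in S}\|u\varphi(f)u^*-\psi(f)\|, \qquad d_\partial(\varphi,\psi)=\sup_{t\in[0,1]}\max_{1\le i\le m}|\xi^\varphi_i(t)-\xi^\psi_i(t)|, \] and $d_W(\varphi,\psi)=\sup_{f\in\mathcal L}d_W(\varphi(f),\psi(f))$, where for self-adjoint $a,b\in B$ \[ d_W(a,b)=\sup_{U\subseteq\mathbb R\text{ open}}\inf\{r>0\mid f_U(a)\precsim f_{U_r}(b),\ f_U(b)\precsim f_{U_r}(a)\}, \] $U_r$ is the open $r$-neighbourhood of $U$, $f_O\colon\mathbb R\to[0,\infty)$ denotes a continuous function with $\{f_O\neq0\}=O$,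 and $\precsim$ is Cuntz subequivalence in $B$ ($x\precsim y$ if $z_nyz_n^*\to x$ for some sequence $(z_n)$ in $B$). -/

import Mathlib

open scoped unitInterval ENNReal Matrix.Norms.L2Operator

/-! ### One dimensional NCCW complexes -/

/-- Gluing data of a one dimensional NCCW complex: finite dimensional C*-algebras `E`, `F` and
(not necessarily unital) *-homomorphisms `α₀, α₁ : E → F` such that `α₀ ⊕ α₁` is injective. -/
structure OneDimNCCW (E F : Type*) [CStarAlgebra E] [FiniteDimensional ℂ E]
    [CStarAlgebra F] [FiniteDimensional ℂ F] where
  /-- the gluing map at the endpoint `0` -/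
  α₀ : E →⋆ₙₐ[ℂ] F
  /-- the gluing map at the endpoint `1` -/
  α₁ : E →⋆ₙₐ[ℂ] F
  injective : Function.Injective fun g : E => (α₀ g, α₁ g)

/-- The pullback `{(f, g) ∈ C([0,1], F) ⊕ E | f(0) = α₀(g), f(1) = α₁(g)}`, as a (possibly
non-unital) *-subalgebra of `C([0,1], F) ⊕ E`. -/
def OneDimNCCW.algebra {E F : Type*} [CStarAlgebra E] [FiniteDimensional ℂ E]
    [CStarAlgebra F] [FiniteDimensional ℂ F] (D : OneDimNCCW E F) :
    NonUnitalStarSubalgebra ℂ (C(I, F) × E) where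
  carrier := {x | x.1 0 = D.α₀ x.2 ∧ x.1 1 = D.α₁ x.2}
  add_mem' := by
    rintro a b ⟨ha, ha'⟩ ⟨hb, hb'⟩
    simp [ha, ha', hb, hb']
  zero_mem' := by simp
  mul_mem' := by
    rintro a b ⟨ha, ha'⟩ ⟨hb, hb'⟩
    simp [ha, ha', hb, hb']
  smul_mem' := by
    rintro c a ⟨ha, ha'⟩
    simp [ha, ha']
  star_mem' := by
    rintro a ⟨ha, ha'⟩
    simp [ha, ha', map_star]

/-- The finite dimensional C*-algebra `M_{d 0} ⊕ ⋯ ⊕ M_{d (k-1)}`. -/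
abbrev MatrixSum {k : ℕ} (d : Fin k → ℕ) : Type :=
  ∀ j : Fin k, Matrix (Fin (d j)) (Fin (d j)) ℂ

/-- A *-homomorphism on a direct sum of matrix algebras is supported on a single component if
there is at most one summand on which it is nonzero. -/
def SupportedOnOneComponent {k m : ℕ} {d : Fin k → ℕ}
    (α : MatrixSum d →⋆ₙₐ[ℂ] Matrix (Fin m) (Fin m) ℂ) : Prop :=
  {j : Fin k | ∃ x : Matrix (Fin (d j)) (Fin (d j)) ℂ, α (Pi.single j x) ≠ 0}.Subsingleton

/-- A nice one dimensional NCCW complex: it is supported on one line (`F` is the single matrix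
algebra `M_m`), and each of `α₀`, `α₁` is supported on a single component of `E`. -/
structure OneDimNCCW.IsNice {k m : ℕ} {d : Fin k → ℕ}
    (D : OneDimNCCW (MatrixSum d) (Matrix (Fin m) (Fin m) ℂ)) : Prop where
  left : SupportedOnOneComponent D.α₀
  right : SupportedOnOneComponent D.α₁

/-! ### Diagonal homomorphisms out of `C([0,1])` -/

/-- The continuous maps `ξ 0 ≤ ⋯ ≤ ξ (m-1)` are associated to `φ : C([0,1]) → C([0,1], M_m)`:
pointwise, `φ(f)(t) = u(t) diag(f(ξ₀(t)), …, f(ξ_{m-1}(t))) u(t)*` with `u(t)` unitary, not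
depending on `f` (and not assumed to be continuous in `t`). -/
def IsAssociated {m : ℕ} (φ : C(I, ℂ) → C(I, Matrix (Fin m) (Fin m) ℂ))
    (ξ : Fin m → C(I, I)) : Prop :=
  (∀ t : I, Monotone fun i => ξ i t) ∧
    ∀ t : I, ∃ u ∈ Matrix.unitaryGroup (Fin m) ℂ, ∀ f : C(I, ℂ),
      φ f t = u * Matrix.diagonal (fun i => f (ξ i t)) * star u

/-- The diagonal distance `sup_t max_i |ξ_i(t) - ζ_i(t)|`. -/
noncomputable def diagonalDist {m : ℕ} (ξ ζ : Fin m → C(I, I)) : ℝ≥0∞ :=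
  ⨆ (t : I) (i : Fin m), edist (ξ i t) (ζ i t)

/-! ### The unitary distance -/

/-- The unitary distance between `φ` and `ψ` relative to `L`: the supremum over finite `S ⊆ L` of
`inf_u sup_{f ∈ S} ‖u φ(f) u* - ψ(f)‖`, with `u` ranging over the unitaries of the unital
C*-algebra `B`. -/
noncomputable def unitaryDist {A B : Type*} [CStarAlgebra A] [CStarAlgebra B] (L : Set A)
    (φ ψ : A →⋆ₐ[ℂ] B) : ℝ≥0∞ :=
  ⨆ (S : Finset A) (_ : (S : Set A) ⊆ L), ⨅ u : unitary B, ⨆ f ∈ S,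
    ‖(u : B) * φ f * star (u : B) - ψ f‖ₑ

/-! ### The Cuntz distance -/

/-- Cuntz subequivalence `a ≾ b`. -/
def CuntzLE {B : Type*} [CStarAlgebra B] (a b : B) : Prop :=
  ∃ x : ℕ → B, Filter.Tendsto (fun n => x n * b * star (x n)) Filter.atTop (nhds a)

/-- The function `x ↦ min(1, d(x, Uᶜ))`, a continuous function `ℝ → [0,1]` whose open support
is `U` when `U` is open (it is constantly `1` for `U = ℝ`). -/
noncomputable def bump (U : Set ℝ) (x : ℝ) : ℝ :=
  (min 1 (Metric.infEDist x Uᶜ)).toReal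

theorem bump_nonneg (U : Set ℝ) (x : ℝ) : 0 ≤ bump U x := ENNReal.toReal_nonneg

theorem continuous_bump (U : Set ℝ) : Continuous (bump U) := by
  refine ENNReal.continuousOn_toReal.comp_continuous
    (continuous_const.min Metric.continuous_infEDist) fun x => ?_
  exact ((min_le_left _ _).trans_lt ENNReal.one_lt_top).ne

theorem bump_ne_zero_iff {U : Set ℝ} (hU : IsOpen U) (x : ℝ) : bump U x ≠ 0 ↔ x ∈ U := by
  have hfin : min 1 (Metric.infEDist x Uᶜ) ≠ ⊤ :=
    ((min_le_left _ _).trans_lt ENNReal.one_lt_top).ne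
  have hmem : x ∈ Uᶜ ↔ Metric.infEDist x Uᶜ = 0 := by
    rw [← Metric.mem_closure_iff_infEDist_zero, hU.isClosed_compl.closure_eq]
  rw [bump, ne_eq, ENNReal.toReal_eq_zero_iff, or_iff_left hfin, min_eq_iff]
  constructor
  · intro h
    by_contra hx
    exact h (Or.inr ⟨hmem.1 hx, by simp [hmem.1 hx]⟩)
  · rintro hx (h | h)
    · simp at h
    · exact hmem.2 h.1 hx

/-- The Cuntz distance between self-adjoint elements: the supremum over open `U ⊆ ℝ` of the
infimum of those `r > 0` with `f_U(a) ≾ f_{U_r}(b)` and `f_U(b) ≾ f_{U_r}(a)`, where `U_r` is the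
open `r`-neighbourhood of `U` and `f_O` is a nonnegative continuous function with open support
`O`, applied through the continuous functional calculus. -/
noncomputable def cuntzDistElem {B : Type*} [CStarAlgebra B] (a b : B) : ℝ≥0∞ :=
  ⨆ (U : Set ℝ) (_ : IsOpen U), ⨅ (r : ℝ)
    (_ : 0 < r ∧ CuntzLE (cfc (bump U) a) (cfc (bump (Metric.thickening r U)) b) ∧
      CuntzLE (cfc (bump U) b) (cfc (bump (Metric.thickening r U)) a)), ENNReal.ofReal r

/-- The Cuntz distance between `φ` and `ψ` relative to a family `L` of self-adjoint elements. -/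
noncomputable def cuntzDist {A B : Type*} [CStarAlgebra A] [CStarAlgebra B] (L : Set A)
    (φ ψ : A →⋆ₐ[ℂ] B) : ℝ≥0∞ :=
  ⨆ f ∈ L, cuntzDistElem (φ f) (ψ f)

/-- `Lip([0,1])`: the real-valued functions with `|f(x) - f(y)| ≤ |x - y|`, viewed in
`C([0,1])`. -/
def lipInterval : Set C(I, ℂ) := {f | IsSelfAdjoint f ∧ LipschitzWith 1 f}

/-! A unital homomorphism from `C([0,1])` to `M_m` is determined by the image of the inclusion, so
over each `t` it is an increasing list of `m` eigenvalues together with a diagonalising unitary.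
Weyl's inequality makes the lists continuous in `t` and, applied to the inclusion, gives `d_∂ ≤
d_U`. For `d_∂ ≤ d_W`, evaluate at `t` and compare ranks with `U = (-∞, c)`: Cuntz subequivalence
cannot raise the number of nonzero eigenvalues.

Both upper bounds need a unitary of `B`. If `v` and `w` diagonalise the fibres of `φ` and `ψ` at
`t`, then `w v*` matches the two eigenbases in increasing order, which is optimal at `t`. Such
unitaries form a closed relation over `[0,1]` whose fibres are path-connected, because the unitary
group of a commutant in `M_m` is connected. Hence a continuous path with prescribed end points
exists inside any open neighbourhood of the relation (`exists_continuous_selection`), and the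
estimates wanted are open conditions.

The end points must come from one unitary of `E`. Niceness gives this: each `α` factors through one
block, and a unital map of matrix algebras repeats a sorted diagonal in sorted order, so the sorted
matching in that block is sent to a sorted matching in `M_m` (`exists_diagonalizers_map`). The
resulting unitary (`exists_unitary_forall_mem`) yields both `d_U ≤ d_∂` and, after cutting down and
rescaling, `d_W ≤ d_∂`. -/

/-! ### Diagonal form of homomorphisms from `C([0,1])` to `M_n`. -/

/-- The inclusion `[0,1] → ℂ`. -/
noncomputable def inclComplex : C(I, ℂ) := ⟨fun t => ((t : ℝ) : ℂ), by fun_prop⟩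

theorem inclComplex_apply (t : I) : inclComplex t = ((t : ℝ) : ℂ) := rfl

theorem isSelfAdjoint_inclComplex : IsSelfAdjoint inclComplex := by
  ext t; simp [inclComplex_apply]

open scoped CStarAlgebra in
/-- Star homomorphisms on `C([0,1])` are determined by the inclusion. -/
theorem starAlgHom_ext_inclComplex {A : Type*} [CStarAlgebra A] {φ ψ : C(I, ℂ) →⋆ₐ[ℂ] A}
    (h : φ inclComplex = ψ inclComplex) : φ = ψ := by
  have hsep : (StarAlgebra.adjoin ℂ {inclComplex}).SeparatesPoints := by
    intro x y hxy
    refine ⟨inclComplex, ⟨inclComplex, StarAlgebra.self_mem_adjoin_singleton ℂ _, rfl⟩, ?_⟩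
    simpa [inclComplex_apply] using fun h => hxy (Subtype.ext h)
  have htop := ContinuousMap.starSubalgebra_topologicalClosure_eq_top_of_separatesPoints _ hsep
  have hle : StarAlgebra.adjoin ℂ {inclComplex} ≤ StarAlgHom.equalizer φ ψ :=
    StarAlgebra.adjoin_le (by simpa using h)
  have hcl : IsClosed (StarAlgHom.equalizer φ ψ : Set C(I, ℂ)) :=
    isClosed_eq (map_continuous φ) (map_continuous ψ)
  have := StarSubalgebra.topologicalClosure_minimal hle hcl
  rw [htop] at this
  ext1 f
  exact this (show f ∈ (⊤ : StarSubalgebra ℂ C(I, ℂ)) from trivial)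

/-- The star homomorphism `f ↦ u diag(f(η₀), …, f(η_{n-1})) u*`. -/
noncomputable def conjDiagHom {n : ℕ} (u : unitary (Matrix (Fin n) (Fin n) ℂ)) (η : Fin n → I) :
    C(I, ℂ) →⋆ₐ[ℂ] Matrix (Fin n) (Fin n) ℂ where
  toFun f := u * Matrix.diagonal (fun i => f (η i)) * star (u : Matrix (Fin n) (Fin n) ℂ)
  map_one' := by
    simp only [ContinuousMap.one_apply, Matrix.diagonal_one, mul_one]
    exact Unitary.coe_mul_star_self u
  map_zero' := by simp
  map_mul' f g := by
    have h := Unitary.coe_star_mul_self u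
    simp only [ContinuousMap.mul_apply, ← Matrix.diagonal_mul_diagonal']
    simp only [mul_assoc]
    congr 2
    rw [← mul_assoc (star (u : Matrix (Fin n) (Fin n) ℂ)), h, one_mul]
  map_add' f g := by
    simp only [ContinuousMap.add_apply, ← Matrix.diagonal_add, mul_add, add_mul]
  commutes' c := by
    simp only [Algebra.algebraMap_eq_smul_one c, ContinuousMap.smul_apply,
      ContinuousMap.one_apply, smul_eq_mul, mul_one]
    rw [show Matrix.diagonal (fun _ : Fin n => c) = algebraMap ℂ (Matrix (Fin n) (Fin n) ℂ) c by
      rw [Matrix.algebraMap_eq_diagonal]; rfl, ← Algebra.commutes, mul_assoc,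
      Unitary.mul_star_self_of_mem u.2, mul_one, Algebra.algebraMap_eq_smul_one]
  map_star' f := by
    simp only [star_mul, star_star, mul_assoc]
    rw [Matrix.star_eq_conjTranspose (Matrix.diagonal _), Matrix.diagonal_conjTranspose]
    rfl

theorem conjDiagHom_apply {n : ℕ} (u : unitary (Matrix (Fin n) (Fin n) ℂ)) (η : Fin n → I)
    (f : C(I, ℂ)) : conjDiagHom u η f =
      u * Matrix.diagonal (fun i => f (η i)) * star (u : Matrix (Fin n) (Fin n) ℂ) := rfl

/-- A Hermitian matrix is diagonalised by a unitary, with increasing eigenvalues. -/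
theorem exists_unitary_monotone_diagonal {n : ℕ} {a : Matrix (Fin n) (Fin n) ℂ}
    (ha : a.IsHermitian) : ∃ (u : unitary (Matrix (Fin n) (Fin n) ℂ)) (l : Fin n → ℝ),
      Monotone l ∧ a = u * Matrix.diagonal (fun i => (l i : ℂ)) *
        star (u : Matrix (Fin n) (Fin n) ℂ) := by
  set τ := Tuple.sort ha.eigenvalues
  set U : Matrix (Fin n) (Fin n) ℂ := ha.eigenvectorUnitary.1
  have hs : star (U.submatrix id τ) = (star U).submatrix τ id := rfl
  have hU : U.submatrix id τ ∈ unitary (Matrix (Fin n) (Fin n) ℂ) := by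
    rw [Unitary.mem_iff]
    constructor
    · rw [hs]
      have := Matrix.submatrix_mul_equiv (star U) U τ (Equiv.refl _) τ
      erw [this, Unitary.coe_star_mul_self]
      simp
    · rw [hs, Matrix.submatrix_mul_equiv, Unitary.mul_star_self_of_mem ha.eigenvectorUnitary.2]
      simp
  refine ⟨⟨_, hU⟩, ha.eigenvalues ∘ τ, Tuple.monotone_sort _, ?_⟩
  have hd : Matrix.diagonal (fun i => (((ha.eigenvalues ∘ τ) i : ℝ) : ℂ)) =
      (Matrix.diagonal (RCLike.ofReal ∘ ha.eigenvalues : Fin n → ℂ)).submatrix τ τ := by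
    rw [Matrix.submatrix_diagonal_equiv]; rfl
  rw [hd]
  change a = U.submatrix id τ * _ * star (U.submatrix id τ)
  rw [hs, Matrix.submatrix_mul_equiv, Matrix.submatrix_mul_equiv]
  exact ha.spectral_theorem

/-- Unital star homomorphisms `C([0,1]) → M_n` are diagonal. -/
theorem exists_eq_conjDiagHom {n : ℕ} (χ : C(I, ℂ) →⋆ₐ[ℂ] Matrix (Fin n) (Fin n) ℂ) :
    ∃ (u : unitary (Matrix (Fin n) (Fin n) ℂ)) (η : Fin n → I),
      Monotone η ∧ χ = conjDiagHom u η := by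
  have ha : (χ inclComplex).IsHermitian := isSelfAdjoint_inclComplex.map χ
  obtain ⟨u, l, hl, h⟩ := exists_unitary_monotone_diagonal ha
  have hmem : ∀ i, l i ∈ I := by
    intro i
    have h1 : (l i : ℂ) ∈ spectrum ℂ (χ inclComplex) := by
      rw [h, ← Unitary.conjStarAlgAut_apply (R := Matrix (Fin n) (Fin n) ℂ) (S := ℂ)]
      simp
    have h2 := AlgHom.spectrum_apply_subset χ inclComplex h1
    rw [ContinuousMap.spectrum_eq_range] at h2
    obtain ⟨t, ht⟩ := h2
    rw [inclComplex_apply] at ht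
    rw [← Complex.ofReal_injective ht]
    exact t.2
  refine ⟨u, fun i => ⟨l i, hmem i⟩, fun i j hij => hl hij, starAlgHom_ext_inclComplex ?_⟩
  rw [h]; rfl

/-! ### Weyl's inequality and rank semicontinuity. -/

theorem star_dotProduct_conj_diagonal {n : ℕ} (v : Matrix (Fin n) (Fin n) ℂ) (α : Fin n → ℝ)
    (x : Fin n → ℂ) :
    star x ⬝ᵥ ((v * Matrix.diagonal (fun i => (α i : ℂ)) * star v).mulVec x) =
      ((∑ j, α j * ‖(star v).mulVec x j‖ ^ 2 : ℝ) : ℂ) := by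
  rw [← Matrix.mulVec_mulVec, ← Matrix.mulVec_mulVec, Matrix.dotProduct_mulVec,
    show Matrix.vecMul (star x) v = star ((star v).mulVec x) by
      rw [Matrix.star_mulVec, Matrix.star_eq_conjTranspose, Matrix.conjTranspose_conjTranspose],
    dotProduct]
  push_cast
  refine Finset.sum_congr rfl fun j _ => ?_
  rw [Matrix.mulVec_diagonal, ← Complex.conj_mul', Pi.star_apply, RCLike.star_def]
  ring

theorem sum_norm_sq_star_mulVec {n : ℕ} (v : unitary (Matrix (Fin n) (Fin n) ℂ))
    (x : Fin n → ℂ) :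
    ∑ j, ‖(star (v : Matrix (Fin n) (Fin n) ℂ)).mulVec x j‖ ^ 2 = ∑ j, ‖x j‖ ^ 2 := by
  have h1 := star_dotProduct_conj_diagonal (v : Matrix (Fin n) (Fin n) ℂ) (fun _ => 1) x
  have h2 := star_dotProduct_conj_diagonal (1 : Matrix (Fin n) (Fin n) ℂ) (fun _ => 1) x
  simp only [Complex.ofReal_one, Matrix.diagonal_one, mul_one, one_mul,
    star_one, Matrix.one_mulVec] at h1 h2
  rw [Unitary.mul_star_self_of_mem v.2, Matrix.one_mulVec, h2] at h1
  exact (Complex.ofReal_injective h1).symm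

theorem norm_star_dotProduct_mulVec_le {n : ℕ} (a : Matrix (Fin n) (Fin n) ℂ) (x : Fin n → ℂ) :
    ‖star x ⬝ᵥ a.mulVec x‖ ≤ ‖a‖ * ∑ j, ‖x j‖ ^ 2 := by
  have h1 := norm_inner_le_norm (𝕜 := ℂ) (WithLp.toLp 2 x) (WithLp.toLp 2 (a.mulVec x))
  rw [EuclideanSpace.inner_toLp_toLp, dotProduct_comm] at h1
  have h2 := a.l2_opNorm_mulVec (WithLp.toLp 2 x)
  have h3 : ‖WithLp.toLp 2 x‖ ^ 2 = ∑ j, ‖x j‖ ^ 2 := EuclideanSpace.norm_sq_eq _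
  rw [← h3]
  calc _ ≤ _ := h1
    _ ≤ ‖WithLp.toLp 2 x‖ * (‖a‖ * ‖WithLp.toLp 2 x‖) := by gcongr; exact h2
    _ = _ := by ring

/-- Weyl's inequality, one half. -/
theorem sub_le_norm_sub_of_diagonal {n : ℕ} (v w : unitary (Matrix (Fin n) (Fin n) ℂ))
    {α β : Fin n → ℝ} (hα : Monotone α) (hβ : Monotone β) (i : Fin n) :
    β i - α i ≤ ‖(v : Matrix (Fin n) (Fin n) ℂ) * Matrix.diagonal (fun i => (α i : ℂ)) *
      star (v : Matrix (Fin n) (Fin n) ℂ) - w * Matrix.diagonal (fun i => (β i : ℂ)) *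
      star (w : Matrix (Fin n) (Fin n) ℂ)‖ := by
  set V := (v : Matrix (Fin n) (Fin n) ℂ) with hV
  set W := (w : Matrix (Fin n) (Fin n) ℂ) with hW
  -- A kernel vector `x` of these `n - 1` equations has `(V* x)_j = 0` for `j > i` and `(W* x)_j =
  -- 0` for `j < i`. On it the first form is at most `α i ‖x‖²` and the second at least `β i ‖x‖²`.
  let N : Matrix {j // j ≠ i} (Fin n) ℂ :=
    Matrix.of fun j => if i < j then star V j else star W j
  have hker : LinearMap.ker N.mulVecLin ≠ ⊥ := by
    apply LinearMap.ker_ne_bot_of_finrank_lt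
    simp only [Module.finrank_fintype_fun_eq_card, Fintype.card_subtype_compl,
      Fintype.card_fin, Fintype.card_unique]
    have := i.pos
    omega
  obtain ⟨x, hx, hx0⟩ := (Submodule.ne_bot_iff _).1 hker
  have hx' : ∀ j : {j // j ≠ i}, N.mulVec x j = 0 := fun j => congrFun hx j
  have hpos : 0 < ∑ j, ‖x j‖ ^ 2 := by
    obtain ⟨j, hj⟩ := Function.ne_iff.1 hx0
    have hj' : 0 < ‖x j‖ := norm_pos_iff.2 hj
    exact Finset.sum_pos' (fun _ _ => by positivity) ⟨j, Finset.mem_univ _, by positivity⟩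
  have hy : ∑ j, α j * ‖(star V).mulVec x j‖ ^ 2 ≤ α i * ∑ j, ‖x j‖ ^ 2 := by
    rw [← sum_norm_sq_star_mulVec v, Finset.mul_sum]
    refine Finset.sum_le_sum fun j _ => ?_
    rcases le_or_gt j i with hj | hj
    · gcongr
      exact hα hj
    · have := hx' ⟨j, hj.ne'⟩
      simp only [N, Matrix.mulVec, Matrix.of_apply, hj, if_true] at this
      have h0 : (star V).mulVec x j = 0 := this
      rw [← hV, h0]
      simp
  have hz : β i * ∑ j, ‖x j‖ ^ 2 ≤ ∑ j, β j * ‖(star W).mulVec x j‖ ^ 2 := by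
    rw [← sum_norm_sq_star_mulVec w, Finset.mul_sum]
    refine Finset.sum_le_sum fun j _ => ?_
    rcases le_or_gt i j with hj | hj
    · gcongr
      exact hβ hj
    · have := hx' ⟨j, hj.ne⟩
      simp only [N, Matrix.mulVec, Matrix.of_apply, hj.not_gt, if_false] at this
      have h0 : (star W).mulVec x j = 0 := this
      rw [← hW, h0]
      simp
  have hb := norm_star_dotProduct_mulVec_le (V * Matrix.diagonal (fun i => (α i : ℂ)) * star V -
    W * Matrix.diagonal (fun i => (β i : ℂ)) * star W) x
  rw [Matrix.sub_mulVec, dotProduct_sub, star_dotProduct_conj_diagonal,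
    star_dotProduct_conj_diagonal, ← Complex.ofReal_sub, Complex.norm_real, Real.norm_eq_abs,
    abs_sub_comm] at hb
  refine le_of_mul_le_mul_right ?_ hpos
  rw [sub_mul]
  linarith [le_abs_self (∑ j, β j * ‖(star W).mulVec x j‖ ^ 2 -
    ∑ j, α j * ‖(star V).mulVec x j‖ ^ 2)]

/-- Weyl's inequality for the increasingly ordered eigenvalues. -/
theorem abs_sub_le_norm_sub_of_diagonal {n : ℕ} (v w : unitary (Matrix (Fin n) (Fin n) ℂ))
    {α β : Fin n → ℝ} (hα : Monotone α) (hβ : Monotone β) (i : Fin n) :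
    |α i - β i| ≤ ‖(v : Matrix (Fin n) (Fin n) ℂ) * Matrix.diagonal (fun i => (α i : ℂ)) *
      star (v : Matrix (Fin n) (Fin n) ℂ) - w * Matrix.diagonal (fun i => (β i : ℂ)) *
      star (w : Matrix (Fin n) (Fin n) ℂ)‖ := by
  rw [abs_sub_le_iff]
  refine ⟨?_, sub_le_norm_sub_of_diagonal v w hα hβ i⟩
  rw [norm_sub_rev]
  exact sub_le_norm_sub_of_diagonal w v hβ hα i

theorem dist_le_norm_conjDiagHom_sub {n : ℕ} (v w : unitary (Matrix (Fin n) (Fin n) ℂ))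
    {ξ ζ : Fin n → I} (hξ : Monotone ξ) (hζ : Monotone ζ) (i : Fin n) :
    dist (ξ i) (ζ i) ≤ ‖conjDiagHom v ξ inclComplex - conjDiagHom w ζ inclComplex‖ :=
  abs_sub_le_norm_sub_of_diagonal v w (α := fun i => ξ i) (β := fun i => ζ i)
    (fun _ _ h => hξ h) (fun _ _ h => hζ h) i

/-- Sorting removes the ambiguity in the eigenvalue list. This later identifies the lists at an end
point with those inherited from a block of `E`. -/
theorem eq_of_conjDiagHom_eq {n : ℕ} {v w : unitary (Matrix (Fin n) (Fin n) ℂ)}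
    {ξ ζ : Fin n → I} (hξ : Monotone ξ) (hζ : Monotone ζ)
    (h : conjDiagHom v ξ = conjDiagHom w ζ) : ξ = ζ := by
  ext1 i
  have := dist_le_norm_conjDiagHom_sub v w hξ hζ i
  rw [h, sub_self, norm_zero] at this
  exact dist_le_zero.1 this

/-- A limit of `x b x*` has at most as many nonzero eigenvalues as `b`. -/
theorem card_le_of_tendsto_conj {n : ℕ} (v w : unitary (Matrix (Fin n) (Fin n) ℂ))
    {α β : Fin n → ℂ} {x : ℕ → Matrix (Fin n) (Fin n) ℂ}
    (h : Filter.Tendsto (fun k => x k * ((w : Matrix (Fin n) (Fin n) ℂ) * Matrix.diagonal β *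
      star (w : Matrix (Fin n) (Fin n) ℂ)) * star (x k)) Filter.atTop
      (nhds ((v : Matrix (Fin n) (Fin n) ℂ) * Matrix.diagonal α *
      star (v : Matrix (Fin n) (Fin n) ℂ)))) :
    Fintype.card {i // α i ≠ 0} ≤ Fintype.card {i // β i ≠ 0} := by
  by_contra! hlt
  set V := (v : Matrix (Fin n) (Fin n) ℂ)
  set W := (w : Matrix (Fin n) (Fin n) ℂ)
  have hV : star V * V = 1 := Unitary.coe_star_mul_self v
  set y : ℕ → Matrix (Fin n) (Fin n) ℂ :=
    fun k => star V * (x k * (W * Matrix.diagonal β * star W) * star (x k)) * V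
  have hy : Filter.Tendsto y Filter.atTop (nhds (Matrix.diagonal α)) := by
    have := (h.const_mul (star V)).mul_const V
    convert this using 2
    rw [mul_assoc V, ← mul_assoc (star V), hV, one_mul, mul_assoc, hV, mul_one]
  -- The minor of `y k` on the support of `α` vanishes for rank reasons, but it converges to the
  -- product of the nonzero `α i`.
  set s : {i // α i ≠ 0} → Fin n := Subtype.val
  have hdet : Filter.Tendsto (fun k => ((y k).submatrix s s).det) Filter.atTop
      (nhds ((Matrix.diagonal α).submatrix s s).det) := by
    have hc : Continuous fun z : Matrix (Fin n) (Fin n) ℂ => (z.submatrix s s).det :=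
      (continuous_id.matrix_submatrix s s).matrix_det
    exact (hc.tendsto _).comp hy
  have h0 : ∀ k, ((y k).submatrix s s).det = 0 := by
    intro k
    by_contra hne
    have hr : ((y k).submatrix s s).rank = Fintype.card {i // α i ≠ 0} :=
      Matrix.rank_of_isUnit _ ((Matrix.isUnit_iff_isUnit_det _).2 (isUnit_iff_ne_zero.2 hne))
    have h1 := Matrix.rank_submatrix_le (y k) s s
    have h2 : (y k).rank ≤ (Matrix.diagonal β).rank := by
      simp only [y]
      calc _ ≤ _ := Matrix.rank_mul_le_left _ _
        _ ≤ _ := Matrix.rank_mul_le_right _ _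
        _ ≤ _ := Matrix.rank_mul_le_left _ _
        _ ≤ _ := Matrix.rank_mul_le_right _ _
        _ ≤ _ := Matrix.rank_mul_le_left _ _
        _ ≤ _ := Matrix.rank_mul_le_right _ _
    rw [Matrix.rank_diagonal] at h2
    omega
  have := tendsto_nhds_unique hdet (by simp only [h0]; exact tendsto_const_nhds)
  rw [Matrix.submatrix_diagonal _ _ Subtype.val_injective, Matrix.det_diagonal,
    Finset.prod_eq_zero_iff] at this
  obtain ⟨i, -, hi⟩ := this
  exact i.2 hi

/-! ### Approximate continuous selections. -/

/-- A closed relation over `[0,1]` with path-connected fibres in a compact, locally path-connected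
space admits approximate continuous selections with prescribed end points. -/
theorem exists_continuous_selection {X : Type*} [TopologicalSpace X] [CompactSpace X] [T2Space X]
    [LocallyPathConnectedSpace X] {K G : Set (I × X)} (hK : IsClosed K) (hG : IsOpen G)
    (hKG : K ⊆ G) (hpc : ∀ t, IsPathConnected {x | (t, x) ∈ K}) {x₀ x₁ : X}
    (h₀ : ((0 : I), x₀) ∈ K) (h₁ : ((1 : I), x₁) ∈ K) :
    ∃ γ : C(I, X), γ 0 = x₀ ∧ γ 1 = x₁ ∧ ∀ t, (t, γ t) ∈ G := by
  have hloc : ∀ s : I, ∃ (J : Set I) (O : Set X), IsOpen J ∧ s ∈ J ∧ IsPathConnected O ∧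
      (∀ t ∈ J, {x | (t, x) ∈ K} ⊆ O) ∧ ∀ t ∈ J, ∀ x ∈ O, (t, x) ∈ G := by
    intro s
    have hKs : IsCompact {x | (s, x) ∈ K} :=
      (hK.preimage (by fun_prop : Continuous (Prod.mk s))).isCompact
    obtain ⟨J₁, O₁, hJ₁, hO₁, hs, hO, hJO⟩ := generalized_tube_lemma (isCompact_singleton (x := s))
      hKs hG (by rintro ⟨t, x⟩ ⟨rfl, hx⟩; exact hKG hx)
    obtain ⟨x, hx⟩ := (hpc s).nonempty
    -- Local path-connectedness makes this component open, and it contains the whole fibre over `s`.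
    -- By compactness of `X` it then contains all fibres over nearby parameters.
    set O := pathComponentIn O₁ x
    have hOo : IsOpen O := hO₁.pathComponentIn x
    have hsub : {x | (s, x) ∈ K} ⊆ O := (hpc s).subset_pathComponentIn hx hO
    have hcl : IsClosed (Prod.fst '' (K ∩ Set.univ ×ˢ Oᶜ)) :=
      isClosedMap_fst_of_compactSpace _ (hK.inter (isClosed_univ.prod hOo.isClosed_compl))
    refine ⟨J₁ ∩ (Prod.fst '' (K ∩ Set.univ ×ˢ Oᶜ))ᶜ, O, hJ₁.inter hcl.isOpen_compl, ⟨hs rfl, ?_⟩,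
      isPathConnected_pathComponentIn (hO hx), ?_, ?_⟩
    · rintro ⟨⟨t, y⟩, ⟨hy, -, hyO⟩, rfl⟩
      exact hyO (hsub hy)
    · intro t ht y hy
      by_contra hyO
      exact ht.2 ⟨(t, y), ⟨hy, trivial, hyO⟩, rfl⟩
    · exact fun t ht y hy => hJO ⟨ht.1, pathComponentIn_subset hy⟩
  choose J O hJ hsJ hO hKO hJO using hloc
  obtain ⟨t, ht0, htm, ⟨N, hN⟩, ht⟩ := exists_monotone_Icc_subset_open_cover_unitInterval hJ
    fun s _ => Set.mem_iUnion.2 ⟨s, hsJ s⟩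
  have hy : ∀ s : I, ∃ y, (s, y) ∈ K ∧ (s = 0 → y = x₀) ∧ (s = 1 → y = x₁) := by
    intro s
    by_cases hs0 : s = 0
    · subst hs0
      exact ⟨x₀, h₀, fun _ => rfl, fun h => absurd h zero_ne_one⟩
    by_cases hs1 : s = 1
    · subst hs1
      exact ⟨x₁, h₁, fun h => absurd h one_ne_zero, fun _ => rfl⟩
    obtain ⟨y, hy⟩ := (hpc s).nonempty
    exact ⟨y, hy, fun h => absurd h hs0, fun h => absurd h hs1⟩
  choose y hyK hy0 hy1 using hy
  -- At each subdivision point the path returns to the relation itself, and so lies in both the old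
  -- and the new path-connected set.
  have key : ∀ n, ∃ γ : I → X, Continuous γ ∧ γ 0 = x₀ ∧ γ (t n) = y (t n) ∧
      ∀ s ≤ t n, (s, γ s) ∈ G := by
    intro n
    induction n with
    | zero =>
      refine ⟨fun _ => x₀, continuous_const, rfl, ?_, ?_⟩
      · rw [ht0, hy0 0 rfl]
      · intro s hs
        rw [ht0] at hs
        rw [le_antisymm hs s.2.1]
        exact hKG h₀
    | succ n ih =>
      obtain ⟨γ, hγ, hγ0, hγn, hγG⟩ := ih
      -- Subdivision points may repeat; a degenerate interval must be skipped before rescaling by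
      -- its length.
      rcases (htm n.le_succ).eq_or_lt with heq | hlt
      · exact ⟨γ, hγ, hγ0, by rw [← heq, hγn], by rwa [← heq]⟩
      obtain ⟨i, hi⟩ := ht n
      have hmem : ∀ s ∈ Set.Icc (t n) (t (n + 1)), s ∈ J i := fun s hs => hi hs
      have hj := (hO i).joinedIn (y (t n))
        (hKO i _ (hmem _ (Set.left_mem_Icc.2 hlt.le)) (hyK _)) (y (t (n + 1)))
        (hKO i _ (hmem _ (Set.right_mem_Icc.2 hlt.le)) (hyK _))
      obtain ⟨p, hp⟩ := hj
      have hlt' : (0 : ℝ) < t (n + 1) - t n := sub_pos.2 hlt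
      refine ⟨fun s => if s ≤ t n then γ s else
        p.extend (((s : ℝ) - t n) / ((t (n + 1) : ℝ) - t n)), ?_, ?_, ?_, ?_⟩
      · refine hγ.if_le ?_ continuous_id continuous_const ?_
        · exact p.continuous_extend.comp (by fun_prop)
        · rintro s rfl
          simp [hγn]
      · exact (if_pos (t n).2.1).trans hγ0
      · refine (if_neg hlt.not_ge).trans ?_
        rw [div_self hlt'.ne', p.extend_one]
      · intro s hs
        by_cases hsn : s ≤ t n
        · simpa only [if_pos hsn] using hγG s hsn
        · simp only [if_neg hsn]
          refine hJO i s (hmem s ⟨(not_le.1 hsn).le, hs⟩) _ ?_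
          obtain ⟨r, hr⟩ := p.extend_range ▸ Set.mem_range_self
            (((s : ℝ) - t n) / ((t (n + 1) : ℝ) - t n))
          rw [← hr]
          exact hp r
  obtain ⟨γ, hγ, hγ0, hγ1, hγG⟩ := key N
  rw [hN N le_rfl] at hγ1 hγG
  exact ⟨⟨γ, hγ⟩, hγ0, hγ1.trans (hy1 1 rfl), fun s => hγG s s.2.2⟩

/-! ### Connectedness of sets of diagonalising unitaries. -/

instance compactSpace_unitary_matrix (n : ℕ) :
    CompactSpace (unitary (Matrix (Fin n) (Fin n) ℂ)) := by
  have : ProperSpace (Matrix (Fin n) (Fin n) ℂ) := FiniteDimensional.proper ℂ _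
  refine isCompact_iff_compactSpace.1 (Metric.isCompact_of_isClosed_isBounded ?_ ?_)
  · exact isClosed_unitary
  · refine (Metric.isBounded_closedBall (x := 0) (r := 1)).subset fun u hu => ?_
    rw [mem_closedBall_zero_iff]
    rcases subsingleton_or_nontrivial (Matrix (Fin n) (Fin n) ℂ) with h | h
    · rw [Subsingleton.elim u 0, norm_zero]; exact zero_le_one
    · exact (CStarRing.norm_of_mem_unitary hu).le

theorem circle_smul_mem_unitary {n : ℕ} (z : Circle)
    (c : unitary (Matrix (Fin n) (Fin n) ℂ)) :
    (z : ℂ) • (c : Matrix (Fin n) (Fin n) ℂ) ∈ unitary (Matrix (Fin n) (Fin n) ℂ) := by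
  refine Unitary.smul_mem_of_mem ?_ c.2
  rw [Unitary.mem_iff, RCLike.star_def, Complex.conj_mul', Complex.mul_conj', Circle.norm_coe]
  simp

/-- The bound says that `-1` is not in the spectrum. A finite spectrum can be rotated off `-1`,
which makes the principal logarithm available. -/
theorem exists_circle_smul_norm_sub_one_lt_two {n : ℕ}
    (c : unitary (Matrix (Fin n) (Fin n) ℂ)) :
    ∃ z : Circle, ‖(z : ℂ) • (c : Matrix (Fin n) (Fin n) ℂ) - 1‖ < 2 := by
  by_contra! h
  have hmem : ∀ z : Circle, (z : ℂ) • (c : Matrix (Fin n) (Fin n) ℂ) ∈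
      unitary (Matrix (Fin n) (Fin n) ℂ) := fun z =>
    circle_smul_mem_unitary z c
  have hspec : ∀ z : Circle, -((z⁻¹ : Circle) : ℂ) ∈ spectrum ℂ (c : Matrix (Fin n) (Fin n) ℂ) := by
    intro z
    have h1 : (-1 : ℂ) ∈ spectrum ℂ ((z : ℂ) • (c : Matrix (Fin n) (Fin n) ℂ)) := by
      by_contra hn
      exact (h z).not_gt ((Unitary.norm_sub_one_lt_two_iff (hmem z)).2 hn)
    rw [← spectrum.smul_mem_smul_iff (r := Circle.toUnits z)]
    have h2 : (Circle.toUnits z) • (-((z⁻¹ : Circle) : ℂ)) = -1 := ?_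
    · rw [h2]; exact h1
    change (z : ℂ) * _ = _
    rw [Circle.coe_inv, mul_neg, mul_inv_cancel₀ (Circle.coe_ne_zero z)]
  have hfin : (Set.range fun z : Circle => -((z⁻¹ : Circle) : ℂ)).Finite :=
    (Matrix.finite_spectrum _).subset (Set.range_subset_iff.2 hspec)
  have hinj : Function.Injective fun z : Circle => -((z⁻¹ : Circle) : ℂ) := fun a b hab =>
    inv_injective (Circle.coe_injective (neg_injective hab))
  have : Finite Circle := (Set.finite_range_iff hinj).1 hfin
  have hne : (Set.univ : Set Circle).Nontrivial :=
    ⟨1, trivial, Circle.exp Real.pi, trivial, fun h => by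
      have := congrArg (fun z : Circle => (z : ℂ).re) h
      norm_num [Circle.coe_exp] at this⟩
  exact (isPreconnected_univ.infinite_of_nontrivial hne) Set.finite_univ

/-- The unitary matrices commuting with a self-adjoint set form a path-connected set. -/
theorem isPathConnected_commuting_unitary {n : ℕ} {T : Set (Matrix (Fin n) (Fin n) ℂ)}
    (hT : ∀ b ∈ T, star b ∈ T) :
    IsPathConnected {c : unitary (Matrix (Fin n) (Fin n) ℂ) |
      ∀ b ∈ T, Commute (c : Matrix (Fin n) (Fin n) ℂ) b} := by
  refine ⟨1, fun b _ => by simp, fun {c} hc => ?_⟩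
  obtain ⟨z, hz⟩ := exists_circle_smul_norm_sub_one_lt_two c
  have hmem : ∀ z : Circle, (z : ℂ) • (c : Matrix (Fin n) (Fin n) ℂ) ∈
      unitary (Matrix (Fin n) (Fin n) ℂ) := fun z =>
    circle_smul_mem_unitary z c
  let r : Circle → unitary (Matrix (Fin n) (Fin n) ℂ) := fun z => ⟨_, hmem z⟩
  have hr : Continuous r := by
    refine Continuous.subtype_mk ?_ _
    fun_prop
  have hrc : ∀ z, ∀ b ∈ T, Commute ((r z : Matrix (Fin n) (Fin n) ℂ)) b := fun z b hb =>
    (hc b hb).smul_left _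
  have h1 : JoinedIn {c : unitary (Matrix (Fin n) (Fin n) ℂ) |
      ∀ b ∈ T, Commute (c : Matrix (Fin n) (Fin n) ℂ) b} (r z) (r 1) := by
    refine ((isPathConnected_univ.image hr).joinedIn _ ⟨z, trivial, rfl⟩ _ ⟨1, trivial, rfl⟩).mono ?_
    rintro _ ⟨z, -, rfl⟩
    exact hrc z
  have h2 : r 1 = c := Subtype.ext (one_smul ℂ _)
  rw [h2] at h1
  refine JoinedIn.trans ?_ h1
  -- After the scalar rotation, contract along `exp(i s a)` with `a` the argument of `r z`. As `a`
  -- is a continuous function of `r z`, it commutes with `T`; this uses that `T` is closed under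
  -- adjoints.
  refine ⟨(selfAdjoint.expUnitaryPathToOne (Unitary.argSelfAdjoint (r z))).cast rfl
    (expUnitary_argSelfAdjoint hz).symm, fun s b hb => ?_⟩
  have h3 : Commute (star (r z : Matrix (Fin n) (Fin n) ℂ)) b := by
    have := (hrc z _ (hT b hb)).star_star
    rwa [star_star] at this
  have h4 : Commute ((Unitary.argSelfAdjoint (r z) : selfAdjoint _) :
      Matrix (Fin n) (Fin n) ℂ) b := Commute.cfc (hrc z b hb) h3 _
  change Commute ((selfAdjoint.expUnitary ((s : ℝ) • Unitary.argSelfAdjoint (r z)) :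
    unitary (Matrix (Fin n) (Fin n) ℂ)) : Matrix (Fin n) (Fin n) ℂ) b
  rw [selfAdjoint.expUnitary_coe]
  refine (Commute.exp_right (Commute.smul_right ?_ _)).symm
  exact (h4.smul_left (s : ℝ)).symm

/-- Presents the diagonalising unitaries as the translate by `v₀` of the unitary group of a
commutant. -/
theorem conjDiagHom_eq_iff_commute {n : ℕ} (v₀ v : unitary (Matrix (Fin n) (Fin n) ℂ))
    (η : Fin n → I) : conjDiagHom v₀ η = conjDiagHom v η ↔
      ∀ b ∈ Set.range fun f : C(I, ℂ) => Matrix.diagonal fun i => f (η i),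
        Commute ((star v₀ * v : unitary (Matrix (Fin n) (Fin n) ℂ)) :
          Matrix (Fin n) (Fin n) ℂ) b := by
  simp only [Set.forall_mem_range]
  rw [DFunLike.ext_iff]
  refine forall_congr' fun f => ?_
  rw [conjDiagHom_apply, conjDiagHom_apply]
  set d := Matrix.diagonal fun i => f (η i)
  have e1 := Unitary.star_mul_self_of_mem v.2
  have e2 := Unitary.star_mul_self_of_mem v₀.2
  have e3 := Unitary.mul_star_self_of_mem v.2
  have e4 := Unitary.mul_star_self_of_mem v₀.2
  change _ ↔ (star (v₀ : Matrix (Fin n) (Fin n) ℂ) * v) * d =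
    d * (star (v₀ : Matrix (Fin n) (Fin n) ℂ) * v)
  generalize (v : Matrix (Fin n) (Fin n) ℂ) = V at *
  generalize (v₀ : Matrix (Fin n) (Fin n) ℂ) = W at *
  constructor
  · intro h
    calc star W * V * d = star W * (V * d * star V) * V := by
          simp only [mul_assoc, e1, mul_one]
      _ = (star W * W) * d * (star W * V) := by rw [← h]; simp only [mul_assoc]
      _ = _ := by rw [e2, one_mul]
  · intro h
    calc W * d * star W = W * (d * (star W * V)) * star V := by
          simp only [mul_assoc, e3, mul_one]
      _ = (W * star W) * V * d * star V := by rw [← h]; simp only [mul_assoc]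
      _ = _ := by rw [e4, one_mul]

/-- The unitaries implementing a given diagonalisation form a path-connected set. -/
theorem isPathConnected_diagonalizers {n : ℕ} (v₀ : unitary (Matrix (Fin n) (Fin n) ℂ))
    (η : Fin n → I) : IsPathConnected {v | conjDiagHom v₀ η = conjDiagHom v η} := by
  have hT : ∀ b ∈ Set.range fun f : C(I, ℂ) => Matrix.diagonal fun i => f (η i),
      star b ∈ Set.range fun f : C(I, ℂ) => Matrix.diagonal fun i => f (η i) := by
    rintro _ ⟨f, rfl⟩
    refine ⟨star f, ?_⟩
    rw [Matrix.star_eq_conjTranspose, Matrix.diagonal_conjTranspose]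
    rfl
  convert (isPathConnected_commuting_unitary hT).image
    (continuous_const_mul v₀) using 1
  ext v
  simp only [Set.mem_ofPred_eq, Set.mem_image, conjDiagHom_eq_iff_commute]
  constructor
  · intro h
    exact ⟨star v₀ * v, h, by rw [← mul_assoc, Unitary.mul_star_self, one_mul]⟩
  · rintro ⟨c, hc, rfl⟩
    rwa [← mul_assoc, Unitary.star_mul_self, one_mul]

/-! ### Associated maps and continuous intertwiners. -/

/-- The fibre at `t` of a homomorphism into `C([0,1], M_m)`. -/
noncomputable def fibreHom {m : ℕ} (Φ : C(I, ℂ) →⋆ₐ[ℂ] C(I, Matrix (Fin m) (Fin m) ℂ)) (t : I) :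
    C(I, ℂ) →⋆ₐ[ℂ] Matrix (Fin m) (Fin m) ℂ where
  toFun f := Φ f t
  map_one' := by simp
  map_zero' := by simp
  map_mul' f g := by simp
  map_add' f g := by simp
  commutes' c := by
    rw [Algebra.algebraMap_eq_smul_one, Algebra.algebraMap_eq_smul_one, map_smul, map_one]
    rfl
  map_star' f := by rw [map_star]; rfl

theorem fibreHom_apply {m : ℕ} (Φ : C(I, ℂ) →⋆ₐ[ℂ] C(I, Matrix (Fin m) (Fin m) ℂ)) (t : I)
    (f : C(I, ℂ)) : fibreHom Φ t f = Φ f t := rfl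

theorem isAssociated_iff {m : ℕ} (Φ : C(I, ℂ) →⋆ₐ[ℂ] C(I, Matrix (Fin m) (Fin m) ℂ))
    (ξ : Fin m → C(I, I)) : IsAssociated Φ ξ ↔ (∀ t, Monotone fun i => ξ i t) ∧
      ∀ t, ∃ v, fibreHom Φ t = conjDiagHom v fun i => ξ i t := by
  refine and_congr Iff.rfl (forall_congr' fun t => ?_)
  constructor
  · rintro ⟨u, hu, h⟩
    exact ⟨⟨u, hu⟩, StarAlgHom.ext h⟩
  · rintro ⟨v, h⟩
    exact ⟨v, v.2, fun f => DFunLike.congr_fun h f⟩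

/-- Continuity comes from Weyl's inequality: each sorted eigenvalue moves no more than the image of
the inclusion does. The unitaries need not vary continuously. -/
theorem exists_isAssociated {m : ℕ} (Φ : C(I, ℂ) →⋆ₐ[ℂ] C(I, Matrix (Fin m) (Fin m) ℂ)) :
    ∃ ξ : Fin m → C(I, I), IsAssociated Φ ξ := by
  choose v η hη h using fun t => exists_eq_conjDiagHom (fibreHom Φ t)
  refine ⟨fun i => ⟨fun t => η t i, ?_⟩, (isAssociated_iff _ _).2 ⟨hη, fun t => ⟨v t, h t⟩⟩⟩
  rw [continuous_iff_continuousAt]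
  intro t
  rw [ContinuousAt, tendsto_iff_dist_tendsto_zero]
  have hc : Filter.Tendsto (fun s => ‖Φ inclComplex s - Φ inclComplex t‖) (nhds t) (nhds 0) := by
    have := ((Φ inclComplex).continuous.sub (continuous_const (y := Φ inclComplex t))).norm.tendsto t
    simpa using this
  refine squeeze_zero (fun _ => dist_nonneg) (fun s => ?_) hc
  have := dist_le_norm_conjDiagHom_sub (v s) (v t) (hη s) (hη t) i
  rwa [← h, ← h] at this

/-- The unitaries of the form `w v*`, where `v` diagonalises the fibre of `Φ` and `w` that of `Ψ`,
admit approximate continuous selections. -/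
theorem exists_continuous_intertwiner {m : ℕ}
    {Φ Ψ : C(I, ℂ) →⋆ₐ[ℂ] C(I, Matrix (Fin m) (Fin m) ℂ)} {ξ ζ : Fin m → C(I, I)}
    (hΦ : ∀ t, ∃ v, fibreHom Φ t = conjDiagHom v fun i => ξ i t)
    (hΨ : ∀ t, ∃ w, fibreHom Ψ t = conjDiagHom w fun i => ζ i t)
    {G : Set (I × unitary (Matrix (Fin m) (Fin m) ℂ))} (hG : IsOpen G)
    (hKG : ∀ t v w, (fibreHom Φ t = conjDiagHom v fun i => ξ i t) →
      (fibreHom Ψ t = conjDiagHom w fun i => ζ i t) → (t, w * star v) ∈ G)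
    {v₀ w₀ v₁ w₁ : unitary (Matrix (Fin m) (Fin m) ℂ)}
    (hv₀ : fibreHom Φ 0 = conjDiagHom v₀ fun i => ξ i 0)
    (hw₀ : fibreHom Ψ 0 = conjDiagHom w₀ fun i => ζ i 0)
    (hv₁ : fibreHom Φ 1 = conjDiagHom v₁ fun i => ξ i 1)
    (hw₁ : fibreHom Ψ 1 = conjDiagHom w₁ fun i => ζ i 1) :
    ∃ γ : C(I, unitary (Matrix (Fin m) (Fin m) ℂ)), γ 0 = w₀ * star v₀ ∧ γ 1 = w₁ * star v₁ ∧
      ∀ t, (t, γ t) ∈ G := by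
  have hclosed : ∀ (Θ : C(I, ℂ) →⋆ₐ[ℂ] C(I, Matrix (Fin m) (Fin m) ℂ)) (η : Fin m → C(I, I)),
      IsClosed {p : I × unitary (Matrix (Fin m) (Fin m) ℂ) |
        fibreHom Θ p.1 = conjDiagHom p.2 fun i => η i p.1} := by
    intro Θ η
    have : {p : I × unitary (Matrix (Fin m) (Fin m) ℂ) |
        fibreHom Θ p.1 = conjDiagHom p.2 fun i => η i p.1} =
        ⋂ f : C(I, ℂ), {p | Θ f p.1 = (p.2 : Matrix (Fin m) (Fin m) ℂ) *
          Matrix.diagonal (fun i => f (η i p.1)) * star (p.2 : Matrix (Fin m) (Fin m) ℂ)} := by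
      ext p
      simp only [Set.mem_ofPred_eq, Set.mem_iInter, DFunLike.ext_iff, fibreHom_apply,
        conjDiagHom_apply]
    rw [this]
    refine isClosed_iInter fun f => isClosed_eq (by fun_prop) ?_
    have hd : Continuous fun p : I × unitary (Matrix (Fin m) (Fin m) ℂ) =>
        (Matrix.diagonal fun i => f (η i p.1) : Matrix (Fin m) (Fin m) ℂ) :=
      Continuous.matrix_diagonal (continuous_pi fun i => by fun_prop)
    have hu : Continuous fun p : I × unitary (Matrix (Fin m) (Fin m) ℂ) =>
        (p.2 : Matrix (Fin m) (Fin m) ℂ) := by fun_prop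
    exact (hu.mul hd).mul hu.star
  set S : Set (I × unitary (Matrix (Fin m) (Fin m) ℂ) × unitary (Matrix (Fin m) (Fin m) ℂ)) :=
    {p | (fibreHom Φ p.1 = conjDiagHom p.2.1 fun i => ξ i p.1) ∧
      fibreHom Ψ p.1 = conjDiagHom p.2.2 fun i => ζ i p.1}
  have hS : IsClosed S :=
    ((hclosed Φ ξ).preimage (f := fun p : I × unitary (Matrix (Fin m) (Fin m) ℂ) ×
      unitary (Matrix (Fin m) (Fin m) ℂ) => (p.1, p.2.1)) (by fun_prop)).inter
    ((hclosed Ψ ζ).preimage (f := fun p : I × unitary (Matrix (Fin m) (Fin m) ℂ) ×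
      unitary (Matrix (Fin m) (Fin m) ℂ) => (p.1, p.2.2)) (by fun_prop))
  set F : I × unitary (Matrix (Fin m) (Fin m) ℂ) × unitary (Matrix (Fin m) (Fin m) ℂ) →
    I × unitary (Matrix (Fin m) (Fin m) ℂ) := fun p => (p.1, p.2.2 * star p.2.1)
  have hF : Continuous F := by fun_prop
  -- The relation of all `(t, w v*)` is closed as the image of a compact set; each fibre is the
  -- image of a product of two path-connected sets.
  refine exists_continuous_selection (K := F '' S) (hS.isCompact.image hF).isClosed hG ?_ ?_
    ⟨(0, v₀, w₀), ⟨hv₀, hw₀⟩, rfl⟩ ⟨(1, v₁, w₁), ⟨hv₁, hw₁⟩, rfl⟩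
  · rintro _ ⟨p, hp, rfl⟩
    exact hKG _ _ _ hp.1 hp.2
  · intro t
    obtain ⟨v, hv⟩ := hΦ t
    obtain ⟨w, hw⟩ := hΨ t
    convert ((isPathConnected_diagonalizers v fun i => ξ i t).prod
      (isPathConnected_diagonalizers w fun i => ζ i t)).image
      (f := fun p => p.2 * star p.1) (by fun_prop) using 1
    ext u
    simp only [Set.mem_ofPred_eq, Set.mem_image, Set.mem_prod, ← hv, ← hw]
    constructor
    · rintro ⟨⟨s, a, b⟩, hp, h⟩
      obtain ⟨rfl, rfl⟩ := Prod.mk.inj h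
      exact ⟨(a, b), hp, rfl⟩
    · rintro ⟨⟨a, b⟩, hp, rfl⟩
      exact ⟨(t, a, b), hp, rfl⟩

/-! ### Sorted diagonals under the gluing maps. -/

/-- Unital star homomorphisms between matrix algebras are, on the diagonal matrices, an increasing
inflation up to unitary conjugation. -/
theorem exists_map_diagonal_eq {n m : ℕ}
    (β : Matrix (Fin n) (Fin n) ℂ →⋆ₐ[ℂ] Matrix (Fin m) (Fin m) ℂ) :
    ∃ (V : unitary (Matrix (Fin m) (Fin m) ℂ)) (s : Fin m → Fin n), Monotone s ∧
      ∀ c : Fin n → ℂ, β (Matrix.diagonal c) =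
        (V : Matrix (Fin m) (Fin m) ℂ) * Matrix.diagonal (c ∘ s) *
          star (V : Matrix (Fin m) (Fin m) ℂ) := by
  -- Distinct increasing sample points encode the diagonal matrices as the image of `C([0,1])`, so
  -- the known diagonal form applies to `β` composed with this map.
  let η : Fin n → I := fun i => ⟨(i : ℝ) / n, by positivity,
    div_le_one_of_le₀ (by exact_mod_cast i.2.le) (by positivity)⟩
  have hη : StrictMono η := by
    intro i j hij
    have hn : (0 : ℝ) < n := by exact_mod_cast i.pos
    have hij' : (i : ℝ) < j := by exact_mod_cast hij
    exact Subtype.mk_lt_mk.2 (by gcongr)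
  have hχ : ∀ f : C(I, ℂ), β.comp (conjDiagHom 1 η) f = β (Matrix.diagonal fun i => f (η i)) := by
    intro f
    simp [conjDiagHom_apply]
  obtain ⟨V, θ, hθ, h⟩ := exists_eq_conjDiagHom (β.comp (conjDiagHom 1 η))
  have hmem : ∀ i, ∃ k, η k = θ i := by
    intro i
    -- This polynomial vanishes exactly at the sample points and is killed by the composite, so
    -- every eigenvalue `θ i` is a sample point.
    let f : C(I, ℂ) := ∏ k, (inclComplex - ContinuousMap.const I ((η k : ℝ) : ℂ))
    have hf : ∀ t, f t = ∏ k, (((t : ℝ) : ℂ) - ((η k : ℝ) : ℂ)) := by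
      intro t
      simp [f, ContinuousMap.prod_apply, inclComplex_apply]
    have h0 : conjDiagHom V θ f = 0 := by
      rw [← h, hχ]
      have : (Matrix.diagonal fun i => f (η i)) = (0 : Matrix (Fin n) (Fin n) ℂ) := by
        rw [← Matrix.diagonal_zero]
        congr 1
        ext j
        rw [hf]
        exact Finset.prod_eq_zero (Finset.mem_univ j) (sub_self _)
      rw [this, map_zero]
    have h1 : (Matrix.diagonal fun i => f (θ i)) = (0 : Matrix (Fin m) (Fin m) ℂ) := by
      have e1 := Unitary.star_mul_self_of_mem V.2
      calc _ = (star (V : Matrix (Fin m) (Fin m) ℂ) * V) * (Matrix.diagonal fun i => f (θ i)) *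
            (star (V : Matrix (Fin m) (Fin m) ℂ) * V) := by rw [e1, one_mul, mul_one]
        _ = star (V : Matrix (Fin m) (Fin m) ℂ) * conjDiagHom V θ f * V := by
            rw [conjDiagHom_apply]; simp only [mul_assoc]
        _ = 0 := by rw [h0, mul_zero, zero_mul]
    have h2 : f (θ i) = 0 := by
      have := congrFun (congrFun h1 i) i
      rwa [Matrix.diagonal_apply_eq] at this
    rw [hf, Finset.prod_eq_zero_iff] at h2
    obtain ⟨k, -, hk⟩ := h2
    exact ⟨k, Subtype.ext (Complex.ofReal_injective (sub_eq_zero.1 hk)).symm⟩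
  choose s hs using hmem
  refine ⟨V, s, fun i j hij => ?_, fun c => ?_⟩
  · rw [← hη.le_iff_le, hs, hs]
    exact hθ hij
  · have hcl : Topology.IsClosedEmbedding η :=
      (continuous_of_discreteTopology).isClosedEmbedding hη.injective
    obtain ⟨f, hf⟩ := ContinuousMap.exists_extension hcl
      (⟨c, continuous_of_discreteTopology⟩ : C(Fin n, ℂ))
    have hf' : ∀ i, f (η i) = c i := fun i => DFunLike.congr_fun hf i
    have h3 := DFunLike.congr_fun h f
    rw [hχ, conjDiagHom_apply] at h3
    simp only [← hs, hf'] at h3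
    exact h3

/-- The restriction of `α` to a component on which it is supported. -/
theorem exists_component {k m : ℕ} [NeZero m] {d : Fin k → ℕ}
    {α : MatrixSum d →⋆ₙₐ[ℂ] Matrix (Fin m) (Fin m) ℂ} (hα : SupportedOnOneComponent α)
    (h1 : α 1 = 1) : ∃ (j : Fin k)
      (β : Matrix (Fin (d j)) (Fin (d j)) ℂ →⋆ₐ[ℂ] Matrix (Fin m) (Fin m) ℂ),
      ∀ x, α x = β (x j) := by
  have hsum : ∀ x, α x = ∑ j, α (Pi.single j (x j)) := by
    intro x
    conv_lhs => rw [← Finset.univ_sum_single x]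
    rw [map_sum]
  obtain ⟨j, hj⟩ : ∃ j, α (Pi.single j 1) ≠ 0 := by
    by_contra! h
    have := hsum 1
    simp only [Pi.one_apply, h, Finset.sum_const_zero, h1] at this
    exact one_ne_zero this
  have hx : ∀ x, α x = α (Pi.single j (x j)) := by
    intro x
    rw [hsum]
    refine Finset.sum_eq_single j (fun i _ hij => ?_) (by simp)
    by_contra hne
    exact hij (hα ⟨_, hne⟩ ⟨_, hj⟩)
  exact ⟨j, {
    toFun := fun y => α (Pi.single j y)
    map_one' := by
      rw [← Pi.one_apply (M := fun j => Matrix (Fin (d j)) (Fin (d j)) ℂ) j, ← hx, h1]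
    map_zero' := by simp
    map_mul' := fun a b => by rw [Pi.single_mul, map_mul]
    map_add' := fun a b => by rw [Pi.single_add, map_add]
    commutes' := fun c => by
      have : (algebraMap ℂ (Matrix (Fin (d j)) (Fin (d j)) ℂ) c) = (c • (1 : MatrixSum d)) j := by
        rw [Algebra.algebraMap_eq_smul_one]; rfl
      rw [this, ← hx, map_smul, h1, Algebra.algebraMap_eq_smul_one]
    map_star' := fun a => by rw [← map_star, Pi.single_star] }, hx⟩

/-- A unital homomorphism supported on one component turns componentwise diagonalisations into a
diagonalisation. -/
theorem exists_diagonalizers_map {k m : ℕ} [NeZero m] {d : Fin k → ℕ}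
    {α : MatrixSum d →⋆ₙₐ[ℂ] Matrix (Fin m) (Fin m) ℂ} (hα : SupportedOnOneComponent α)
    (h1 : α 1 = 1) {q₁ q₂ : C(I, ℂ) → MatrixSum d}
    {v w : ∀ j, unitary (Matrix (Fin (d j)) (Fin (d j)) ℂ)} {η θ : ∀ j, Fin (d j) → I}
    (hη : ∀ j, Monotone (η j)) (hθ : ∀ j, Monotone (θ j))
    (hq₁ : ∀ f j, q₁ f j = conjDiagHom (v j) (η j) f)
    (hq₂ : ∀ f j, q₂ f j = conjDiagHom (w j) (θ j) f)
    {ξ ζ : Fin m → I} (hξ : Monotone ξ) (hζ : Monotone ζ)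
    {v' w' : unitary (Matrix (Fin m) (Fin m) ℂ)}
    (hv' : ∀ f, α (q₁ f) = conjDiagHom v' ξ f) (hw' : ∀ f, α (q₂ f) = conjDiagHom w' ζ f) :
    ∃ V W : unitary (Matrix (Fin m) (Fin m) ℂ), conjDiagHom v' ξ = conjDiagHom V ξ ∧
      conjDiagHom w' ζ = conjDiagHom W ζ ∧
      α (fun j => (w j * star (v j) : unitary (Matrix (Fin (d j)) (Fin (d j)) ℂ))) =
        (W * star V : unitary (Matrix (Fin m) (Fin m) ℂ)) := by
  obtain ⟨j, β, hβ⟩ := exists_component hα h1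
  obtain ⟨V, s, hs, hV⟩ := exists_map_diagonal_eq β
  let b := Unitary.map (StarMonoidHom.ofClass β)
  have key : ∀ (x : unitary (Matrix (Fin (d j)) (Fin (d j)) ℂ)) (η : Fin (d j) → I) (f : C(I, ℂ)),
      β (conjDiagHom x η f) = conjDiagHom (b x * V) (η ∘ s) f := by
    intro x η f
    rw [conjDiagHom_apply, conjDiagHom_apply, map_mul, map_mul, hV, map_star]
    simp only [Submonoid.coe_mul, star_mul, mul_assoc]
    rfl
  have e1 : conjDiagHom v' ξ = conjDiagHom (b (v j) * V) (η j ∘ s) :=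
    StarAlgHom.ext fun f => by rw [← hv', hβ, hq₁, key]
  have e2 : conjDiagHom w' ζ = conjDiagHom (b (w j) * V) (θ j ∘ s) :=
    StarAlgHom.ext fun f => by rw [← hw', hβ, hq₂, key]
  -- Monotonicity of `s` keeps the inherited list sorted, so it equals `ξ`. The same `s` and `V`
  -- serve both homomorphisms, and `V` cancels in the product below.
  have e3 := eq_of_conjDiagHom_eq hξ ((hη j).comp hs) e1
  have e4 := eq_of_conjDiagHom_eq hζ ((hθ j).comp hs) e2
  rw [← e3] at e1
  rw [← e4] at e2
  refine ⟨_, _, e1, e2, ?_⟩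
  rw [hβ]
  have : b (w j) * V * star (b (v j) * V) =
      b (w j * star (v j)) := by
    rw [star_mul, map_mul, map_star, mul_assoc, ← mul_assoc V, Unitary.mul_star_self, one_mul]
  rw [this]
  rfl

/-! ### The complex as an algebra of paths. -/

/-- A unit of a one dimensional NCCW complex is the unit of the ambient algebra. -/
theorem OneDimNCCW.eq_one_of_forall_mul {E F : Type*} [CStarAlgebra E] [FiniteDimensional ℂ E]
    [CStarAlgebra F] [FiniteDimensional ℂ F] (D : OneDimNCCW E F) {x : C(I, F) × E}
    (hx : x ∈ D.algebra) (h : ∀ y ∈ D.algebra, x * y = y) : x = 1 := by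
  -- Vanishing at both ends, `s` lies in the complex with zero `E`-component whatever the gluing; it
  -- is invertible inside, which forces `x.1 = 1` there.
  let s : C(I, F) := ⟨fun t => ((t : ℝ) * (1 - t) : ℂ) • (1 : F), by fun_prop⟩
  have hs : ∀ t : I, s t = ((t : ℝ) * (1 - t) : ℂ) • (1 : F) := fun t => rfl
  have hsmem : (s, (0 : E)) ∈ D.algebra := by
    change s 0 = D.α₀ 0 ∧ s 1 = D.α₁ 0
    simp [hs]
  have h1 : x.1 = 1 := by
    have hd : Dense ({0, 1}ᶜ : Set I) := by
      simpa [Set.compl_eq_univ_sdiff] using dense_univ.sdiff_finite (Set.toFinite ({0, 1} : Set I))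
    refine DFunLike.coe_injective (Continuous.ext_on hd x.1.continuous (map_continuous _) ?_)
    intro t ht
    have h2 := DFunLike.congr_fun (congrArg Prod.fst (h _ hsmem)) t
    change x.1 t * s t = s t at h2
    rw [hs, mul_smul_comm, mul_one] at h2
    refine smul_right_injective F ?_ h2
    simp only [Set.mem_compl_iff, Set.mem_insert_iff, Set.mem_singleton_iff, not_or] at ht
    refine mul_ne_zero ?_ ?_
    · exact fun h => ht.1 (Subtype.ext (by exact_mod_cast h))
    · exact fun h => ht.2 (Subtype.ext (by
        have : (1 : ℂ) = ((t : ℝ) : ℂ) := sub_eq_zero.1 h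
        exact_mod_cast this.symm))
  have h0 : D.α₀ x.2 = 1 := by rw [← hx.1, h1]; rfl
  have h0' : D.α₁ x.2 = 1 := by rw [← hx.2, h1]; rfl
  -- Unitality of the gluing maps is not yet known; instead `αᵢ(x.2 · 1) = αᵢ(1)` for both `i`, and
  -- joint injectivity applies.
  have h2 : x.2 = 1 := by
    rw [← mul_one x.2]
    apply D.injective
    simp only [map_mul, h0, h0', one_mul]
  exact Prod.ext h1 h2

section

variable {k m : ℕ} {d : Fin k → ℕ} {D : OneDimNCCW (MatrixSum d) (Matrix (Fin m) (Fin m) ℂ)}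
  {B : Type*} [CStarAlgebra B]

theorem coe_equiv_one (e : B ≃⋆ₐ[ℂ] D.algebra) :
    (e 1 : C(I, Matrix (Fin m) (Fin m) ℂ) × MatrixSum d) = 1 := by
  refine D.eq_one_of_forall_mul (e 1).2 fun y hy => ?_
  have := map_mul e 1 (e.symm ⟨y, hy⟩)
  rw [one_mul, StarAlgEquiv.apply_symm_apply] at this
  exact (congrArg Subtype.val this).symm

/-- An abstract NCCW complex as an algebra of pairs. -/
noncomputable def toPair (e : B ≃⋆ₐ[ℂ] D.algebra) :
    B →⋆ₐ[ℂ] C(I, Matrix (Fin m) (Fin m) ℂ) × MatrixSum d where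
  toFun b := e b
  map_one' := coe_equiv_one e
  map_zero' := by rw [map_zero]; rfl
  map_mul' a b := by rw [map_mul]; rfl
  map_add' a b := by rw [map_add]; rfl
  commutes' c := by
    rw [Algebra.algebraMap_eq_smul_one, Algebra.algebraMap_eq_smul_one, ← coe_equiv_one e]
    exact congrArg Subtype.val (e.map_smul' c 1)
  map_star' a := by rw [map_star]; rfl

/-- The `C([0,1], M_m)`-component. -/
noncomputable def toPath (e : B ≃⋆ₐ[ℂ] D.algebra) : B →⋆ₐ[ℂ] C(I, Matrix (Fin m) (Fin m) ℂ) :=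
  (StarAlgHom.fst ℂ _ _).comp (toPair e)

theorem toPath_apply (e : B ≃⋆ₐ[ℂ] D.algebra) (b : B) : toPath e b =
    (e b : C(I, Matrix (Fin m) (Fin m) ℂ) × MatrixSum d).1 := rfl

theorem toPath_zero (e : B ≃⋆ₐ[ℂ] D.algebra) (b : B) :
    toPath e b 0 = D.α₀ (toPair e b).2 := (e b).2.1

theorem toPath_one (e : B ≃⋆ₐ[ℂ] D.algebra) (b : B) :
    toPath e b 1 = D.α₁ (toPair e b).2 := (e b).2.2

/-- The end values of the path determine the `E`-component by joint injectivity of the gluing maps.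
Norms in `B` can therefore be computed on paths alone. -/
theorem toPath_injective (e : B ≃⋆ₐ[ℂ] D.algebra) : Function.Injective (toPath e) := by
  intro a b h
  refine e.injective (Subtype.ext (Prod.ext h (D.injective ?_)))
  exact Prod.ext ((toPath_zero e a).symm.trans ((DFunLike.congr_fun h 0).trans (toPath_zero e b)))
    ((toPath_one e a).symm.trans ((DFunLike.congr_fun h 1).trans (toPath_one e b)))

theorem norm_toPath (e : B ≃⋆ₐ[ℂ] D.algebra) (b : B) : ‖toPath e b‖ = ‖b‖ :=
  NonUnitalStarAlgHom.norm_map (toPath e) (toPath_injective e) b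

theorem norm_toPath_apply_le (e : B ≃⋆ₐ[ℂ] D.algebra) (b : B) (t : I) : ‖toPath e b t‖ ≤ ‖b‖ :=
  ((toPath e b).norm_coe_le_norm t).trans_eq (norm_toPath e b)

theorem norm_le_of_forall_toPath (e : B ≃⋆ₐ[ℂ] D.algebra) {b : B} {r : ℝ} (hr : 0 ≤ r)
    (h : ∀ t, ‖toPath e b t‖ ≤ r) : ‖b‖ ≤ r := by
  rw [← norm_toPath e]
  exact (ContinuousMap.norm_le _ hr).2 h

/-- Unitaries of `B` are given by paths of unitaries with compatible end points. -/
theorem exists_unitary_toPath_eq (e : B ≃⋆ₐ[ℂ] D.algebra)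
    (γ : C(I, unitary (Matrix (Fin m) (Fin m) ℂ)))
    (g : ∀ j, unitary (Matrix (Fin (d j)) (Fin (d j)) ℂ))
    (h0 : D.α₀ (fun j => (g j : Matrix (Fin (d j)) (Fin (d j)) ℂ)) = γ 0)
    (h1 : D.α₁ (fun j => (g j : Matrix (Fin (d j)) (Fin (d j)) ℂ)) = γ 1) :
    ∃ u : unitary B, ∀ t, toPath e (u : B) t = γ t := by
  let y : C(I, Matrix (Fin m) (Fin m) ℂ) × MatrixSum d :=
    (⟨fun t => γ t, by fun_prop⟩, fun j => g j)
  have hy : y ∈ D.algebra := ⟨h0.symm, h1.symm⟩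
  have hu : ∀ t, toPath e (e.symm ⟨y, hy⟩) t = γ t := by
    intro t
    rw [toPath_apply, StarAlgEquiv.apply_symm_apply]
    rfl
  refine ⟨⟨e.symm ⟨y, hy⟩, ?_⟩, hu⟩
  rw [Unitary.mem_iff]
  constructor <;> refine toPath_injective e (ContinuousMap.ext fun t => ?_)
  · rw [map_mul, map_star, map_one, ContinuousMap.mul_apply, ContinuousMap.star_apply, hu]
    exact Unitary.star_mul_self_of_mem (γ t).2
  · rw [map_mul, map_star, map_one, ContinuousMap.mul_apply, ContinuousMap.star_apply, hu]
    exact Unitary.mul_star_self_of_mem (γ t).2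

/-! ### Intertwining unitaries in the complex. -/

/-- In a nice NCCW complex, pairs of diagonal homomorphisms are approximately intertwined by
unitaries of the complex. -/
theorem exists_unitary_forall_mem [NeZero m] (hD : D.IsNice) (e : B ≃⋆ₐ[ℂ] D.algebra)
    {φ ψ : C(I, ℂ) →⋆ₐ[ℂ] B} {ξ ζ : Fin m → C(I, I)}
    (hφ : IsAssociated ((toPath e).comp φ) ξ) (hψ : IsAssociated ((toPath e).comp ψ) ζ)
    {G : Set (I × unitary (Matrix (Fin m) (Fin m) ℂ))} (hG : IsOpen G)
    (hKG : ∀ t v w, (fibreHom ((toPath e).comp φ) t = conjDiagHom v fun i => ξ i t) →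
      (fibreHom ((toPath e).comp ψ) t = conjDiagHom w fun i => ζ i t) → (t, w * star v) ∈ G) :
    ∃ u : unitary B, ∀ t, ∃ U : unitary (Matrix (Fin m) (Fin m) ℂ),
      toPath e (u : B) t = U ∧ (t, U) ∈ G := by
  obtain ⟨hξ, hφ'⟩ := (isAssociated_iff _ _).1 hφ
  obtain ⟨hζ, hψ'⟩ := (isAssociated_iff _ _).1 hψ
  have hone : toPair e 1 = 1 := map_one _
  have hα₀ : D.α₀ 1 = 1 := by
    have := toPath_zero e 1
    rw [hone, map_one (toPath e), ContinuousMap.one_apply] at this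
    exact this.symm
  have hα₁ : D.α₁ 1 = 1 := by
    have := toPath_one e 1
    rw [hone, map_one (toPath e), ContinuousMap.one_apply] at this
    exact this.symm
  let π : ∀ j, B →⋆ₐ[ℂ] Matrix (Fin (d j)) (Fin (d j)) ℂ := fun j =>
    (Pi.evalStarAlgHom ℂ (fun j => Matrix (Fin (d j)) (Fin (d j)) ℂ) j).comp
      ((StarAlgHom.snd ℂ _ _).comp (toPair e))
  choose v η hη hv using fun j => exists_eq_conjDiagHom ((π j).comp φ)
  choose w θ hθ hw using fun j => exists_eq_conjDiagHom ((π j).comp ψ)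
  have hq₁ : ∀ f j, (toPair e (φ f)).2 j = conjDiagHom (v j) (η j) f := fun f j => by
    rw [← hv]; rfl
  have hq₂ : ∀ f j, (toPair e (ψ f)).2 j = conjDiagHom (w j) (θ j) f := fun f j => by
    rw [← hw]; rfl
  obtain ⟨v₀, hv₀⟩ := hφ' 0
  obtain ⟨w₀, hw₀⟩ := hψ' 0
  obtain ⟨v₁, hv₁⟩ := hφ' 1
  obtain ⟨w₁, hw₁⟩ := hψ' 1
  -- Arbitrary diagonalisers at the ends are replaced by ones whose quotient is the image of `w j *
  -- star (v j)`. One element of `E` thus fits both ends.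
  obtain ⟨V₀, W₀, hV₀, hW₀, h0⟩ := exists_diagonalizers_map hD.left hα₀ hη hθ hq₁ hq₂ (hξ 0) (hζ 0)
    (v' := v₀) (w' := w₀) (fun f => by rw [← hv₀, ← toPath_zero]; rfl)
    (fun f => by rw [← hw₀, ← toPath_zero]; rfl)
  obtain ⟨V₁, W₁, hV₁, hW₁, h1⟩ := exists_diagonalizers_map hD.right hα₁ hη hθ hq₁ hq₂ (hξ 1) (hζ 1)
    (v' := v₁) (w' := w₁) (fun f => by rw [← hv₁, ← toPath_one]; rfl)
    (fun f => by rw [← hw₁, ← toPath_one]; rfl)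
  obtain ⟨γ, hγ0, hγ1, hγ⟩ := exists_continuous_intertwiner hφ' hψ' hG hKG
    (hv₀.trans hV₀) (hw₀.trans hW₀) (hv₁.trans hV₁) (hw₁.trans hW₁)
  obtain ⟨u, hu⟩ := exists_unitary_toPath_eq e γ (fun j => w j * star (v j))
    (by rw [hγ0]; exact h0) (by rw [hγ1]; exact h1)
  exact ⟨u, fun t => ⟨γ t, hu t, hγ t⟩⟩

end

/-! ### Auxiliary facts on distances, conjugation and functional calculus. -/

theorem lt_of_diagonalDist_lt {m : ℕ} {ξ ζ : Fin m → C(I, I)} {r : ℝ}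
    (h : diagonalDist ξ ζ < ENNReal.ofReal r) (t : I) (i : Fin m) :
    dist (ξ i t) (ζ i t) < r := by
  rw [← edist_lt_ofReal]
  exact (le_iSup₂ (f := fun (t : I) (i : Fin m) => edist (ξ i t) (ζ i t)) t i).trans_lt h

theorem diagonalDist_comm {m : ℕ} (ξ ζ : Fin m → C(I, I)) :
    diagonalDist ξ ζ = diagonalDist ζ ξ := by
  simp only [diagonalDist, edist_comm]

theorem inclComplex_mem_lipInterval : inclComplex ∈ lipInterval := by
  refine ⟨isSelfAdjoint_inclComplex, LipschitzWith.of_dist_le_mul fun x y => ?_⟩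
  rw [inclComplex_apply, inclComplex_apply, Complex.dist_eq, ← Complex.ofReal_sub,
    Complex.norm_real, NNReal.coe_one, one_mul]
  rfl

theorem conj_mul_star_conjDiagHom {m : ℕ} (v w : unitary (Matrix (Fin m) (Fin m) ℂ))
    (ξ : Fin m → I) (f : C(I, ℂ)) :
    ((w * star v : unitary (Matrix (Fin m) (Fin m) ℂ)) : Matrix (Fin m) (Fin m) ℂ) *
      conjDiagHom v ξ f * star ((w * star v : unitary (Matrix (Fin m) (Fin m) ℂ)) :
        Matrix (Fin m) (Fin m) ℂ) = conjDiagHom w ξ f := by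
  have e1 := Unitary.star_mul_self_of_mem v.2
  simp only [conjDiagHom_apply, Submonoid.coe_mul, Unitary.coe_star, star_mul, star_star]
  calc _ = (w : Matrix (Fin m) (Fin m) ℂ) * (star (v : Matrix (Fin m) (Fin m) ℂ) * v) *
        Matrix.diagonal (fun i => f (ξ i)) * (star (v : Matrix (Fin m) (Fin m) ℂ) * v) *
        star (w : Matrix (Fin m) (Fin m) ℂ) := by simp only [mul_assoc]
    _ = _ := by rw [e1, mul_one, mul_one]

theorem conj_conjDiagHom {m : ℕ} (u v : unitary (Matrix (Fin m) (Fin m) ℂ))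
    (ξ : Fin m → I) (f : C(I, ℂ)) :
    (u : Matrix (Fin m) (Fin m) ℂ) * conjDiagHom v ξ f * star (u : Matrix (Fin m) (Fin m) ℂ) =
      conjDiagHom (u * v) ξ f := by
  simp only [conjDiagHom_apply, Submonoid.coe_mul, star_mul, mul_assoc]

theorem norm_conj_diagonal {m : ℕ} (w : unitary (Matrix (Fin m) (Fin m) ℂ)) (c : Fin m → ℂ) :
    ‖(w : Matrix (Fin m) (Fin m) ℂ) * Matrix.diagonal c *
      star (w : Matrix (Fin m) (Fin m) ℂ)‖ = ‖c‖ := by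
  rw [← Unitary.coe_star, CStarRing.norm_mul_coe_unitary, CStarRing.norm_coe_unitary_mul,
    Matrix.l2_opNorm_diagonal]

/-- A real-valued continuous function on `[0,1]` as a complex-valued one. -/
noncomputable def ofRealMap (k : C(I, ℝ)) : C(I, ℂ) := ⟨fun t => (k t : ℂ), by fun_prop⟩

theorem ofRealMap_apply (k : C(I, ℝ)) (t : I) : ofRealMap k t = (k t : ℂ) := rfl

theorem star_ofRealMap (k : C(I, ℝ)) : star (ofRealMap k) = ofRealMap k := by
  ext t; simp [ofRealMap_apply]

theorem cuntzLE_of_forall_exists {B : Type*} [CStarAlgebra B] {a b : B}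
    (h : ∀ ε > 0, ∃ x : B, ‖x * b * star x - a‖ ≤ ε) : CuntzLE a b := by
  choose x hx using fun n : ℕ => h (1 / ((n : ℝ) + 1)) Nat.one_div_pos_of_nat
  refine ⟨x, ?_⟩
  rw [tendsto_iff_norm_sub_tendsto_zero]
  exact squeeze_zero (fun _ => norm_nonneg _) hx tendsto_one_div_add_atTop_nhds_zero_nat

theorem cfc_map_eq {B : Type*} [CStarAlgebra B] (φ : C(I, ℂ) →⋆ₐ[ℂ] B) {g : ℝ → ℝ}
    (hg : Continuous g) {f : C(I, ℂ)} (hf : IsSelfAdjoint f) :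
    cfc g (φ f) = φ (ofRealMap ⟨fun t => g (f t).re, by fun_prop⟩) := by
  have hφ : Continuous φ := by
    open scoped CStarAlgebra in exact map_continuous φ
  let G : ℂ → ℂ := fun z => (g z.re : ℂ)
  have hG : Continuous G := by fun_prop
  rw [cfc_real_eq_complex (a := φ f) g (hf.map φ),
    ← StarAlgHomClass.map_cfc φ G f hG.continuousOn hφ hf.isStarNormal (hf.map φ).isStarNormal]
  congr 1
  ext t
  have h1 : (cfc G f) t = cfc G (f t) :=
    StarAlgHomClass.map_cfc (ContinuousMap.evalStarAlgHom ℂ ℂ t) G f hG.continuousOn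
      (continuous_eval_const t) hf.isStarNormal (hf.map _).isStarNormal
  rw [h1]
  exact cfc_algebraMap (A := ℂ) (f t) G

theorem cuntzDistElem_comm {B : Type*} [CStarAlgebra B] (a b : B) :
    cuntzDistElem a b = cuntzDistElem b a := by
  unfold cuntzDistElem
  refine iSup_congr fun U => iSup_congr fun _ => iInf_congr fun r => ?_
  refine iInf_congr_Prop (and_congr_right fun _ => and_comm) fun _ => rfl

/-! ### Comparison of the three distances. -/

section

variable {k m : ℕ} {d : Fin k → ℕ} {D : OneDimNCCW (MatrixSum d) (Matrix (Fin m) (Fin m) ℂ)}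
  {B : Type*} [CStarAlgebra B]

/-- Exact matching by `w v*` leaves the error `max |f(ξ_i) - f(ζ_i)| < r` for each `f` in `S`. Since
`S` is finite these strict bounds define an open set, so an approximate selection suffices. -/
theorem unitaryDist_le_diagonalDist [NeZero m] (hD : D.IsNice) (e : B ≃⋆ₐ[ℂ] D.algebra)
    {φ ψ : C(I, ℂ) →⋆ₐ[ℂ] B} {ξ ζ : Fin m → C(I, I)}
    (hφ : IsAssociated ((toPath e).comp φ) ξ) (hψ : IsAssociated ((toPath e).comp ψ) ζ) :
    unitaryDist lipInterval φ ψ ≤ diagonalDist ξ ζ := by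
  refine iSup₂_le fun S hS => le_of_forall_gt_imp_ge_of_dense fun a ha => ?_
  rcases eq_or_ne a ⊤ with rfl | htop
  · exact le_top
  obtain ⟨r, hr, rfl⟩ : ∃ r : ℝ, 0 ≤ r ∧ a = ENNReal.ofReal r :=
    ⟨a.toReal, ENNReal.toReal_nonneg, (ENNReal.ofReal_toReal htop).symm⟩
  have hr0 : 0 < r := ENNReal.ofReal_pos.1 (bot_le.trans_lt ha)
  let G : Set (I × unitary (Matrix (Fin m) (Fin m) ℂ)) := ⋂ f ∈ S, {p |
    ‖(p.2 : Matrix (Fin m) (Fin m) ℂ) * toPath e (φ f) p.1 *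
      star (p.2 : Matrix (Fin m) (Fin m) ℂ) - toPath e (ψ f) p.1‖ < r}
  have hG : IsOpen G := by
    refine isOpen_biInter_finset fun f _ => isOpen_lt ?_ continuous_const
    fun_prop
  obtain ⟨u, hu⟩ := exists_unitary_forall_mem hD e hφ hψ hG (by
    intro t v w hv hw
    refine Set.mem_iInter₂.2 fun f hf => ?_
    change ‖_ * fibreHom ((toPath e).comp φ) t f * _ - fibreHom ((toPath e).comp ψ) t f‖ < r
    rw [hv, hw, conj_mul_star_conjDiagHom, conjDiagHom_apply, conjDiagHom_apply, ← sub_mul,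
      ← mul_sub, Matrix.diagonal_sub, norm_conj_diagonal, pi_norm_lt_iff hr0]
    intro i
    rw [← dist_eq_norm]
    refine lt_of_le_of_lt ?_ (lt_of_diagonalDist_lt ha t i)
    simpa using (hS hf).2.dist_le_mul (ξ i t) (ζ i t))
  refine iInf_le_of_le u (iSup₂_le fun f hf => ?_)
  rw [← ofReal_norm]
  refine ENNReal.ofReal_le_ofReal (norm_le_of_forall_toPath e hr fun t => ?_)
  obtain ⟨U, hU, hUG⟩ := hu t
  have := Set.mem_iInter₂.1 hUG f hf
  rw [map_sub, map_mul, map_mul, map_star, ContinuousMap.sub_apply, ContinuousMap.mul_apply,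
    ContinuousMap.mul_apply, ContinuousMap.star_apply, hU]
  exact this.le

/-- Conjugation does not change eigenvalues, so Weyl's inequality for the inclusion bounds every
unitary from below. -/
theorem diagonalDist_le_unitaryDist (e : B ≃⋆ₐ[ℂ] D.algebra)
    {φ ψ : C(I, ℂ) →⋆ₐ[ℂ] B} {ξ ζ : Fin m → C(I, I)}
    (hφ : IsAssociated ((toPath e).comp φ) ξ) (hψ : IsAssociated ((toPath e).comp ψ) ζ) :
    diagonalDist ξ ζ ≤ unitaryDist lipInterval φ ψ := by
  obtain ⟨hξ, hφ'⟩ := (isAssociated_iff _ _).1 hφ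
  obtain ⟨hζ, hψ'⟩ := (isAssociated_iff _ _).1 hψ
  refine iSup₂_le fun t i => ?_
  refine le_iSup₂_of_le {inclComplex} (by simpa using inclComplex_mem_lipInterval) ?_
  refine le_iInf fun u => ?_
  refine le_iSup₂_of_le inclComplex (Finset.mem_singleton_self _) ?_
  rw [edist_dist, ← ofReal_norm]
  refine ENNReal.ofReal_le_ofReal ?_
  refine le_trans ?_ (norm_toPath_apply_le e _ t)
  obtain ⟨v, hv⟩ := hφ' t
  obtain ⟨w, hw⟩ := hψ' t
  have hU : toPath e (u : B) t ∈ unitary (Matrix (Fin m) (Fin m) ℂ) := by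
    have h := Unitary.map_mem (toPath e) u.2
    rw [Unitary.mem_iff] at h ⊢
    exact ⟨DFunLike.congr_fun h.1 t, DFunLike.congr_fun h.2 t⟩
  have := dist_le_norm_conjDiagHom_sub (⟨_, hU⟩ * v) w (hξ t) (hζ t) i
  rw [← conj_conjDiagHom, ← hv, ← hw] at this
  rw [map_sub, map_mul, map_mul, map_star]
  exact this

/-- Domination of open supports along the associated maps implies Cuntz subequivalence. -/
theorem cuntzLE_of_ne_zero [NeZero m] (hD : D.IsNice) (e : B ≃⋆ₐ[ℂ] D.algebra)
    {φ ψ : C(I, ℂ) →⋆ₐ[ℂ] B} {ξ ζ : Fin m → C(I, I)}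
    (hφ : IsAssociated ((toPath e).comp φ) ξ) (hψ : IsAssociated ((toPath e).comp ψ) ζ)
    {h h' : C(I, ℝ)} (hpos : ∀ s, 0 ≤ h s) (hpos' : ∀ s, 0 ≤ h' s)
    (hsupp : ∀ t i, h (ξ i t) ≠ 0 → h' (ζ i t) ≠ 0) :
    CuntzLE (φ (ofRealMap h)) (ψ (ofRealMap h')) := by
  refine cuntzLE_of_forall_exists fun ε' hε' => ?_
  obtain ⟨ε, hε, hεε⟩ : ∃ ε : ℝ, 0 < ε ∧ ε + ε ≤ ε' := ⟨ε' / 2, by positivity, by linarith⟩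
  -- Support domination becomes uniform on the compact sets where `h (ξ i t) ≥ ε`.
  obtain ⟨δ, hδ, hδh⟩ : ∃ δ > 0, ∀ i t, ε ≤ h (ξ i t) → δ ≤ h' (ζ i t) := by
    have : ∀ᶠ δ in nhdsWithin (0 : ℝ) (Set.Ioi 0), ∀ i t, ε ≤ h (ξ i t) → δ ≤ h' (ζ i t) := by
      rw [Filter.eventually_all]
      intro i
      have hc : IsCompact {t | ε ≤ h (ξ i t)} :=
        (isClosed_le continuous_const (by fun_prop)).isCompact
      obtain ⟨a, ha, hb⟩ := hc.exists_forall_le' (f := fun t => h' (ζ i t)) (a := 0)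
        (by fun_prop) fun t ht => (hpos' _).lt_of_ne (hsupp t i (hε.trans_le ht).ne').symm
      filter_upwards [Ioo_mem_nhdsGT ha] with δ hδ t ht
      exact hδ.2.le.trans (hb t ht)
    obtain ⟨δ, h1, h2⟩ := (this.and self_mem_nhdsWithin).exists
    exact ⟨δ, h2, h1⟩
  -- Cut `h` down to `κ = (h - ε)₊` with square root `p`, and normalise `h'` by `r = max(h',
  -- δ)^(-1/2)`. Then `r h' r` is `1` along `ζ` wherever `p` is nonzero along `ξ`.
  let κ : C(I, ℝ) := ⟨fun s => max (h s - ε) 0, by fun_prop⟩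
  let p : C(I, ℝ) := ⟨fun s => √(max (h s - ε) 0), by fun_prop⟩
  have hmax : ∀ s, √(max (h' s) δ) ≠ 0 := fun s =>
    (Real.sqrt_pos.2 (hδ.trans_le (le_max_right _ _))).ne'
  let r : C(I, ℝ) := ⟨fun s => (√(max (h' s) δ))⁻¹, Continuous.inv₀ (by fun_prop) hmax⟩
  have hpr : ∀ t i, p (ξ i t) * (r (ζ i t) * h' (ζ i t) * r (ζ i t)) * p (ξ i t) = κ (ξ i t) := by
    intro t i
    have hpp : p (ξ i t) * p (ξ i t) = κ (ξ i t) := Real.mul_self_sqrt (le_max_right _ _)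
    rcases le_or_gt ε (h (ξ i t)) with hle | hlt
    · have hr : r (ζ i t) * h' (ζ i t) * r (ζ i t) = 1 := by
        have hd := hδh i t hle
        change (√(max (h' (ζ i t)) δ))⁻¹ * h' (ζ i t) * (√(max (h' (ζ i t)) δ))⁻¹ = 1
        rw [max_eq_left hd, mul_right_comm, ← mul_inv, Real.mul_self_sqrt (hδ.le.trans hd),
          inv_mul_cancel₀ (hδ.trans_le hd).ne']
      rw [hr, mul_one, hpp]
    · have hκ : κ (ξ i t) = 0 := max_eq_right (by linarith)
      have hp : p (ξ i t) = 0 := by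
        rw [hκ] at hpp
        exact mul_self_eq_zero.1 hpp
      rw [hp, hκ, mul_zero]
  let q : C(I, ℂ) := ofRealMap r * ofRealMap h' * ofRealMap r
  let G : Set (I × unitary (Matrix (Fin m) (Fin m) ℂ)) := {y |
    ‖toPath e (φ (ofRealMap p)) y.1 * (star (y.2 : Matrix (Fin m) (Fin m) ℂ) *
      toPath e (ψ q) y.1 * (y.2 : Matrix (Fin m) (Fin m) ℂ)) * toPath e (φ (ofRealMap p)) y.1 -
      toPath e (φ (ofRealMap κ)) y.1‖ < ε}
  have hG : IsOpen G := by
    refine isOpen_lt ?_ continuous_const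
    fun_prop
  obtain ⟨u, hu⟩ := exists_unitary_forall_mem hD e hφ hψ hG (by
    intro t v w hv hw
    change ‖fibreHom ((toPath e).comp φ) t (ofRealMap p) * (_ *
      fibreHom ((toPath e).comp ψ) t q * _) * fibreHom ((toPath e).comp φ) t (ofRealMap p) -
      fibreHom ((toPath e).comp φ) t (ofRealMap κ)‖ < ε
    have hw' : star ((w * star v : unitary (Matrix (Fin m) (Fin m) ℂ)) :
        Matrix (Fin m) (Fin m) ℂ) * conjDiagHom w (fun i => ζ i t) q *
        ((w * star v : unitary (Matrix (Fin m) (Fin m) ℂ)) : Matrix (Fin m) (Fin m) ℂ) =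
        conjDiagHom v (fun i => ζ i t) q := by
      have := conj_mul_star_conjDiagHom w v (fun i => ζ i t) q
      rw [← this, ← Unitary.coe_star, ← Unitary.coe_star, star_mul, star_star, star_mul, star_star]
    rw [hv, hw, hw']
    have e1 := Unitary.star_mul_self_of_mem v.2
    have : conjDiagHom v (fun i => ξ i t) (ofRealMap p) * conjDiagHom v (fun i => ζ i t) q *
        conjDiagHom v (fun i => ξ i t) (ofRealMap p) =
        conjDiagHom v (fun i => ξ i t) (ofRealMap κ) := by
      simp only [conjDiagHom_apply]
      calc _ = (v : Matrix (Fin m) (Fin m) ℂ) * Matrix.diagonal (fun i => ofRealMap p (ξ i t)) *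
            (star (v : Matrix (Fin m) (Fin m) ℂ) * v) * Matrix.diagonal (fun i => q (ζ i t)) *
            (star (v : Matrix (Fin m) (Fin m) ℂ) * v) *
            Matrix.diagonal (fun i => ofRealMap p (ξ i t)) *
            star (v : Matrix (Fin m) (Fin m) ℂ) := by simp only [mul_assoc]
        _ = (v : Matrix (Fin m) (Fin m) ℂ) * (Matrix.diagonal (fun i => ofRealMap p (ξ i t)) *
            Matrix.diagonal (fun i => q (ζ i t)) *
            Matrix.diagonal (fun i => ofRealMap p (ξ i t))) *
            star (v : Matrix (Fin m) (Fin m) ℂ) := by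
          rw [e1, mul_one, mul_one]; simp only [mul_assoc]
        _ = _ := by
          rw [Matrix.diagonal_mul_diagonal, Matrix.diagonal_mul_diagonal]
          congr 3
          ext i
          simp only [q, ContinuousMap.mul_apply, ofRealMap_apply, ← Complex.ofReal_mul, hpr]
    rw [this, sub_self, norm_zero]
    exact hε)
  -- One `ε` is lost to the approximate intertwiner `u`, the other to replacing `h` by `κ`.
  refine ⟨φ (ofRealMap p) * star (u : B) * ψ (ofRealMap r), ?_⟩
  have hx : φ (ofRealMap p) * star (u : B) * ψ (ofRealMap r) * ψ (ofRealMap h') *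
      star (φ (ofRealMap p) * star (u : B) * ψ (ofRealMap r)) =
      φ (ofRealMap p) * (star (u : B) * ψ q * u) * φ (ofRealMap p) := by
    simp only [star_mul, star_star, ← map_star, star_ofRealMap, q, map_mul, mul_assoc]
  have hb : ‖φ (ofRealMap p) * (star (u : B) * ψ q * u) * φ (ofRealMap p) -
      φ (ofRealMap κ)‖ ≤ ε := by
    refine norm_le_of_forall_toPath e hε.le fun t => ?_
    obtain ⟨U, hU, hUG⟩ := hu t
    rw [map_sub, map_mul, map_mul, map_mul, map_mul, map_star, ContinuousMap.sub_apply,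
      ContinuousMap.mul_apply, ContinuousMap.mul_apply, ContinuousMap.mul_apply,
      ContinuousMap.mul_apply, ContinuousMap.star_apply, hU]
    exact (show _ < ε from hUG).le
  have hk : ‖φ (ofRealMap κ) - φ (ofRealMap h)‖ ≤ ε := by
    rw [← map_sub]
    refine (NonUnitalStarAlgHom.norm_apply_le φ _).trans ((ContinuousMap.norm_le _ hε.le).2 ?_)
    intro s
    rw [ContinuousMap.sub_apply, ofRealMap_apply, ofRealMap_apply, ← Complex.ofReal_sub,
      Complex.norm_real, Real.norm_eq_abs, abs_le]
    change -ε ≤ max (h s - ε) 0 - h s ∧ max (h s - ε) 0 - h s ≤ ε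
    constructor
    · linarith [le_max_left (h s - ε) 0]
    · rw [sub_le_iff_le_add]
      exact max_le (by linarith) (by linarith [hpos s])
  rw [hx]
  exact (norm_sub_le_norm_sub_add_norm_sub _ _ _).trans ((add_le_add hb hk).trans hεε)

/-- If `|ξ_i - ζ_i| < r` and `f` is 1-Lipschitz, then `f(ξ_i) ∈ U` forces `f(ζ_i) ∈ U_r`, so
supports dominate along the matching, and symmetrically. -/
theorem cuntzDist_le_diagonalDist [NeZero m] (hD : D.IsNice) (e : B ≃⋆ₐ[ℂ] D.algebra)
    {φ ψ : C(I, ℂ) →⋆ₐ[ℂ] B} {ξ ζ : Fin m → C(I, I)}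
    (hφ : IsAssociated ((toPath e).comp φ) ξ) (hψ : IsAssociated ((toPath e).comp ψ) ζ) :
    cuntzDist lipInterval φ ψ ≤ diagonalDist ξ ζ := by
  refine iSup₂_le fun f hf => iSup₂_le fun U hU => le_of_forall_gt_imp_ge_of_dense fun a ha => ?_
  rcases eq_or_ne a ⊤ with rfl | htop
  · exact le_top
  obtain ⟨r, rfl⟩ : ∃ r : ℝ, a = ENNReal.ofReal r :=
    ⟨a.toReal, (ENNReal.ofReal_toReal htop).symm⟩
  have hr0 : 0 < r := ENNReal.ofReal_pos.1 (bot_le.trans_lt ha)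
  have hsupp : ∀ x y : I, dist x y < r → bump U (f x).re ≠ 0 →
      bump (Metric.thickening r U) (f y).re ≠ 0 := by
    intro x y hxy hx
    rw [bump_ne_zero_iff hU] at hx
    rw [bump_ne_zero_iff Metric.isOpen_thickening, Metric.mem_thickening_iff]
    refine ⟨_, hx, lt_of_le_of_lt ?_ hxy⟩
    calc dist (f y).re (f x).re = |(f y - f x).re| := by rw [Real.dist_eq, Complex.sub_re]
      _ ≤ ‖f y - f x‖ := Complex.abs_re_le_norm _
      _ = dist (f x) (f y) := by rw [dist_comm, dist_eq_norm]
      _ ≤ dist x y := by simpa using hf.2.dist_le_mul x y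
  refine iInf₂_le r ⟨hr0, ?_, ?_⟩
  · rw [cfc_map_eq φ (continuous_bump _) hf.1, cfc_map_eq ψ (continuous_bump _) hf.1]
    exact cuntzLE_of_ne_zero hD e hφ hψ (fun _ => bump_nonneg _ _) (fun _ => bump_nonneg _ _)
      fun t i => hsupp _ _ (lt_of_diagonalDist_lt ha t i)
  · rw [cfc_map_eq φ (continuous_bump _) hf.1, cfc_map_eq ψ (continuous_bump _) hf.1]
    exact cuntzLE_of_ne_zero hD e hψ hφ (fun _ => bump_nonneg _ _) (fun _ => bump_nonneg _ _)
      fun t i => hsupp _ _ (lt_of_diagonalDist_lt (diagonalDist_comm ξ ζ ▸ ha) t i)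

/-- Take `U = (-∞, c)` with `c` slightly above `ξ_i(t)`. If `r < ζ_i(t) - c`, then `U_r` misses
`ζ_j(t)` for all `j ≥ i`, while `U` contains `ξ_j(t)` for all `j ≤ i`; the ranks at `t` contradict
subequivalence. -/
theorem ofReal_sub_le_cuntzDistElem (e : B ≃⋆ₐ[ℂ] D.algebra)
    {φ ψ : C(I, ℂ) →⋆ₐ[ℂ] B} {ξ ζ : Fin m → C(I, I)}
    (hφ : IsAssociated ((toPath e).comp φ) ξ) (hψ : IsAssociated ((toPath e).comp ψ) ζ)
    (t : I) (i : Fin m) : ENNReal.ofReal ((ζ i t : ℝ) - ξ i t) ≤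
      cuntzDistElem (φ inclComplex) (ψ inclComplex) := by
  obtain ⟨hξ, hφ'⟩ := (isAssociated_iff _ _).1 hφ
  obtain ⟨hζ, hψ'⟩ := (isAssociated_iff _ _).1 hψ
  have key : ∀ c > (ξ i t : ℝ), ENNReal.ofReal ((ζ i t : ℝ) - c) ≤
      cuntzDistElem (φ inclComplex) (ψ inclComplex) := by
    intro c hc
    refine le_iSup₂_of_le (Set.Iio c) isOpen_Iio (le_iInf₂ fun r hr => ?_)
    refine ENNReal.ofReal_le_ofReal (le_of_not_gt fun hlt => ?_)
    obtain ⟨-, ⟨x, hx⟩, -⟩ := hr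
    rw [cfc_map_eq φ (continuous_bump _) isSelfAdjoint_inclComplex,
      cfc_map_eq ψ (continuous_bump _) isSelfAdjoint_inclComplex] at hx
    obtain ⟨v, hv⟩ := hφ' t
    obtain ⟨w, hw⟩ := hψ' t
    have hev : Continuous fun b : B => toPath e b t :=
      (continuous_eval_const t).comp (NonUnitalStarAlgHom.isometry _ (toPath_injective e)).continuous
    have hx' := (hev.tendsto _).comp hx
    simp only [Function.comp_def, map_mul, map_star, ContinuousMap.mul_apply,
      ContinuousMap.star_apply] at hx'
    have hv' := fun f => DFunLike.congr_fun hv f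
    have hw' := fun f => DFunLike.congr_fun hw f
    simp only [fibreHom_apply, StarAlgHom.comp_apply, conjDiagHom_apply] at hv' hw'
    rw [hv', hw'] at hx'
    have hcard := card_le_of_tendsto_conj v w hx'
    have h1 : Fintype.card {j : Fin m // j ≤ i} ≤ Fintype.card {j : Fin m //
        ofRealMap ⟨fun s => bump (Set.Iio c) (inclComplex s).re, by
          have := continuous_bump (Set.Iio c); fun_prop⟩ (ξ j t) ≠ 0} := by
      refine Fintype.card_subtype_mono _ _ fun j hj => ?_
      rw [ofRealMap_apply, Complex.ofReal_ne_zero]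
      have hj' : (ξ j t : ℝ) ≤ ξ i t := hξ t hj
      exact (bump_ne_zero_iff isOpen_Iio _).2 (hj'.trans_lt hc)
    have h2 : Fintype.card {j : Fin m //
        ofRealMap ⟨fun s => bump (Metric.thickening r (Set.Iio c)) (inclComplex s).re, by
          have := continuous_bump (Metric.thickening r (Set.Iio c)); fun_prop⟩ (ζ j t) ≠ 0} ≤
        Fintype.card {j : Fin m // j < i} := by
      refine Fintype.card_subtype_mono _ _ fun j hj => ?_
      rw [ofRealMap_apply, Complex.ofReal_ne_zero] at hj
      have hj' := (bump_ne_zero_iff Metric.isOpen_thickening _).1 hj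
      obtain ⟨y, hy, hyd⟩ := Metric.mem_thickening_iff.1 hj'
      by_contra hij
      have h3 : (ζ i t : ℝ) ≤ ζ j t := hζ t (not_lt.1 hij)
      have h4 : (ζ j t : ℝ) - y < r := (le_abs_self _).trans_lt hyd
      have h5 : y < c := hy
      linarith
    have h3 : Fintype.card {j : Fin m // j < i} < Fintype.card {j : Fin m // j ≤ i} :=
      Fintype.card_lt_of_injective_of_notMem (Subtype.map id fun _ h => le_of_lt h)
        (Subtype.map_injective _ Function.injective_id) (b := ⟨i, le_rfl⟩) (by
          rintro ⟨⟨j, hj⟩, h⟩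
          exact hj.ne (congrArg Subtype.val h))
    omega
  rcases eq_or_ne (cuntzDistElem (φ inclComplex) (ψ inclComplex)) ⊤ with htop | htop
  · rw [htop]; exact le_top
  rw [ENNReal.ofReal_le_iff_le_toReal htop]
  refine le_of_forall_pos_le_add fun ε hε => ?_
  have := key (ξ i t + ε) (by linarith)
  rw [ENNReal.ofReal_le_iff_le_toReal htop] at this
  linarith

theorem diagonalDist_le_cuntzDist (e : B ≃⋆ₐ[ℂ] D.algebra)
    {φ ψ : C(I, ℂ) →⋆ₐ[ℂ] B} {ξ ζ : Fin m → C(I, I)}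
    (hφ : IsAssociated ((toPath e).comp φ) ξ) (hψ : IsAssociated ((toPath e).comp ψ) ζ) :
    diagonalDist ξ ζ ≤ cuntzDist lipInterval φ ψ := by
  refine iSup₂_le fun t i => le_iSup₂_of_le inclComplex inclComplex_mem_lipInterval ?_
  rw [edist_dist, Subtype.dist_eq, Real.dist_eq, abs_eq_max_neg, neg_sub, ENNReal.ofReal_max]
  refine max_le ?_ (ofReal_sub_le_cuntzDistElem e hφ hψ t i)
  rw [cuntzDistElem_comm]
  exact ofReal_sub_le_cuntzDistElem e hψ hφ t i

end

theorem proposition4p11 {k m : ℕ} {d : Fin k → ℕ}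
    (D : OneDimNCCW (MatrixSum d) (Matrix (Fin m) (Fin m) ℂ)) (hD : D.IsNice)
    {B : Type*} [CStarAlgebra B] (e : B ≃⋆ₐ[ℂ] D.algebra)
    (φ ψ : C(I, ℂ) →⋆ₐ[ℂ] B) (hφ : Function.Injective φ) (hψ : Function.Injective ψ) :
    (∃ ξ : Fin m → C(I, I), IsAssociated (fun f => (e (φ f) : C(I, Matrix (Fin m) (Fin m) ℂ) ×
      MatrixSum d).1) ξ) ∧
    (∃ ζ : Fin m → C(I, I), IsAssociated (fun f => (e (ψ f) : C(I, Matrix (Fin m) (Fin m) ℂ) ×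
      MatrixSum d).1) ζ) ∧
    ∀ ξ ζ : Fin m → C(I, I),
      IsAssociated (fun f => (e (φ f) : C(I, Matrix (Fin m) (Fin m) ℂ) × MatrixSum d).1) ξ →
      IsAssociated (fun f => (e (ψ f) : C(I, Matrix (Fin m) (Fin m) ℂ) × MatrixSum d).1) ζ →
      unitaryDist lipInterval φ ψ = diagonalDist ξ ζ ∧
        diagonalDist ξ ζ = cuntzDist lipInterval φ ψ := by
  -- For `m = 0` all paths coincide, so `B` is zero and cannot contain `C([0,1])`.
  have : NeZero m := by
    refine ⟨?_⟩
    rintro rfl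
    have h : φ 0 = φ 1 := toPath_injective e (ContinuousMap.ext fun t => Subsingleton.elim _ _)
    exact zero_ne_one (hφ h)
  refine ⟨exists_isAssociated ((toPath e).comp φ), exists_isAssociated ((toPath e).comp ψ),
    fun ξ ζ hξ hζ => ⟨le_antisymm (unitaryDist_le_diagonalDist hD e hξ hζ)
      (diagonalDist_le_unitaryDist e hξ hζ), le_antisymm (diagonalDist_le_cuntzDist e hξ hζ)
      (cuntzDist_le_diagonalDist hD e hξ hζ)⟩⟩
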